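/- Let $H\in M(n,\mathbb R)$ be a real $n\times n$ matrix all of whose (complex) characteristic roots $h_k$ satisfy $0<\operatorname{Re}(h_k)<1$ and $\operatorname{Re}(h_k)\neq\frac12$, let $D=H-\frac12 I$, and let $t\in\mathbb R$. Write $z_+=\max\{z,0\}$, $z_-=\max\{-z,0\}$, and for $z\ge 0$ let $z^{D}=\exp(\log(z)D)$ if $z>0$ and $z^{D}=0$ if $z=0$. For each choice of the sign $\pm$, all entries of the matrix kernel $$u\mapsto (t-u)_\pm^{D}-(-u)_\pm^{D}$$ belong to $L^2(\mathbb R)$, and its entrywise Fourier transform in the sense of $L^2(\mathbb R)$ satisfies, for almost every $x\in\mathbb R$, $$\int_{\mathbb R}e^{iux}\bigl((t-u)_\pm^{D}-(-u)_\pm^{D}\bigr)\,du=\pm\,\frac{e^{itx}-1}{ix}\,|x|^{-D}\,\Gamma(D+I)\,e^{\mp\operatorname{sign}(x)\,i\pi D/2},$$ where upper signs go together and lower signs go together, and $\Gamma(D+I)$ is the primary matrix function with stem function $\Gamma$ at the matrix $D+I$, i.e. $\Gamma(D+I)=p(D+I)$ for any complex polynomial $p$ such that $p^{(j)}(\lambda)=\Gamma^{(j)}(\lambda)$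 for every root $\lambda$ of the minimal polynomial of $D+I$ and every $j$ smaller than the multiplicity of $\lambda$ as a root of it. Moreover, if $\operatorname{Re}(h_k)<\frac12$ for all $k$, then all entries of the kernel are integrable over $\mathbb R$, and the formula holds for every $x\ne0$ with an absolutely convergent (Lebesgue) integral on the left-hand side. -/

import Mathlib

open MeasureTheory Polynomial
open scoped FourierTransform Nat

noncomputable section

namespace OFBM

/-! ### Primary matrix functions -/

/-- `p` is a Hermite interpolation polynomial of the stem function `f` at the matrix `Λ`: for each
root `z` of the minimal polynomial of `Λ`, with multiplicity `r`, one has `p⁽ʲ⁾(z) = f⁽ʲ⁾(z)` for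
all `j < r`. -/
def Interpolates {n : ℕ} (f : ℂ → ℂ) (Λ : Matrix (Fin n) (Fin n) ℂ) (p : ℂ[X]) : Prop :=
  ∀ z ∈ (minpoly ℂ Λ).roots, ∀ j < (minpoly ℂ Λ).rootMultiplicity z,
    (derivative^[j] p).eval z = iteratedDeriv j f z

theorem iterate_derivative_eval_eq (p : ℂ[X]) (z : ℂ) (j : ℕ) :
    (derivative^[j] p).eval z = (j ! : ℂ) * (taylor z p).coeff j := by
  rw [← factorial_smul_hasseDeriv, taylor_coeff]
  simp

theorem exists_interpolates {n : ℕ} (f : ℂ → ℂ) (Λ : Matrix (Fin n) (Fin n) ℂ) :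
    ∃ p : ℂ[X], Interpolates f Λ p := by
  classical
  set μ := minpoly ℂ Λ
  let c : ℂ → ℂ[X] := fun z =>
    taylor (-z) (∑ j ∈ Finset.range (μ.rootMultiplicity z), C (iteratedDeriv j f z / (j ! : ℂ)) * X ^ j)
  obtain ⟨p, hp⟩ := IsDedekindDomain.exists_forall_sub_mem_ideal
    (s := μ.roots.toFinset) (fun z : ℂ => Ideal.span {(X - C z : ℂ[X])})
    (fun z => μ.rootMultiplicity z)
    (fun z _ => by
      rw [Ideal.prime_iff_isPrime (by simpa using X_sub_C_ne_zero z),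
        Ideal.span_singleton_prime (X_sub_C_ne_zero z)]
      exact prime_X_sub_C z)
    (fun z _ w _ hzw h => by
      rw [Ideal.span_singleton_eq_span_singleton] at h
      have h1 : (X - C w : ℂ[X]).eval z = 0 := by
        obtain ⟨q, hq⟩ := h.dvd
        rw [hq]; simp
      simp [sub_eq_zero] at h1
      exact hzw h1)
    (fun z => c z)
  refine ⟨p, fun z hz j hj => ?_⟩
  have h := hp z (Multiset.mem_toFinset.2 hz)
  rw [Ideal.span_singleton_pow, Ideal.mem_span_singleton] at h
  obtain ⟨q, hq⟩ := h
  have hp' : p = c z + (X - C z) ^ μ.rootMultiplicity z * q := by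
    rw [← hq]; ring
  have hj0 : (j ! : ℂ) ≠ 0 := by exact_mod_cast j.factorial_ne_zero
  rw [iterate_derivative_eval_eq, hp', map_add, coeff_add, taylor_mul, taylor_pow]
  have h2 : taylor z (X - C z : ℂ[X]) = X := by simp
  have h3 : taylor z (c z) = ∑ j ∈ Finset.range (μ.rootMultiplicity z),
      C (iteratedDeriv j f z / (j ! : ℂ)) * X ^ j := by
    simp only [c, taylor_taylor]
    simp
  rw [h2, h3, coeff_X_pow_mul', if_neg (not_le.2 hj)]
  simp only [finsetSum_coeff, coeff_C_mul_X_pow]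
  rw [Finset.sum_ite_eq, if_pos (Finset.mem_range.2 hj)]
  field_simp
  simp

/-- The primary matrix function `f(Λ)` with stem function `f`, i.e. `p(Λ)` for a polynomial `p`
which takes the same values as `f` on the spectrum of `Λ`. It does not depend on `p`
(`primaryMatrixFun_eq`) and is given by the usual formula in terms of a Jordan form
(`primaryMatrixFun_jordan`). -/
def primaryMatrixFun {n : ℕ} (f : ℂ → ℂ) (Λ : Matrix (Fin n) (Fin n) ℂ) :
    Matrix (Fin n) (Fin n) ℂ :=
  aeval Λ (exists_interpolates f Λ).choose

theorem primaryMatrixFun_eq {n : ℕ} (f : ℂ → ℂ) (Λ : Matrix (Fin n) (Fin n) ℂ) (p : ℂ[X])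
    (hp : Interpolates f Λ p) : primaryMatrixFun f Λ = aeval Λ p := by
  set q := (exists_interpolates f Λ).choose
  have hq : Interpolates f Λ q := (exists_interpolates f Λ).choose_spec
  have hμ : minpoly ℂ Λ ≠ 0 := minpoly.ne_zero (Matrix.isIntegral Λ)
  have hdvd : minpoly ℂ Λ ∣ q - p := by
    by_cases h0 : q - p = 0
    · rw [h0]; exact dvd_zero _
    classical
    rw [IsAlgClosed.dvd_iff_roots_le_roots hμ h0, Multiset.le_iff_count]
    intro z
    rw [count_roots, count_roots]
    by_contra! hlt
    have hz : z ∈ (minpoly ℂ Λ).roots := by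
      rw [← Multiset.count_pos, count_roots]; omega
    have := (lt_rootMultiplicity_iff_isRoot_iterate_derivative
      (n := (q - p).rootMultiplicity z) (t := z) h0).2 (fun m hm => by
        rw [IsRoot.def, iterate_derivative_sub, eval_sub, hq z hz m (by omega),
          hp z hz m (by omega), sub_self])
    exact lt_irrefl _ this
  have h := (minpoly.dvd_iff).1 hdvd
  rw [map_sub, sub_eq_zero] at h
  exact h

/-- The (lower triangular) Jordan block of size `m` with eigenvalue `z`. -/
def jordanBlock (m : ℕ) (z : ℂ) : Matrix (Fin m) (Fin m) ℂ :=
  fun i j => if i = j then z else if (i : ℕ) = j + 1 then 1 else 0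

/-- The value of the stem function `f` at the Jordan block of size `m` with eigenvalue `z`. -/
def jordanBlockFun (f : ℂ → ℂ) (m : ℕ) (z : ℂ) : Matrix (Fin m) (Fin m) ℂ :=
  fun i j => if j ≤ i then iteratedDeriv (i - j : ℕ) f z / ((i - j : ℕ) ! : ℂ) else 0

theorem aeval_jordanBlock (m : ℕ) (z : ℂ) (p : ℂ[X]) (i j : Fin m) :
    aeval (jordanBlock m z) p i j = if j ≤ i then (taylor z p).coeff (i - j : ℕ) else 0 := by
  have hpow : ∀ (k : ℕ) (i j : Fin m),
      ((jordanBlock m z - algebraMap ℂ _ z) ^ k) i j = if (i : ℕ) = j + k then 1 else 0 := by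
    intro k
    induction k with
    | zero => intro i j; simp [Matrix.one_apply, Fin.ext_iff]
    | succ k ih =>
      intro i j
      rw [pow_succ, Matrix.mul_apply]
      have hN : ∀ a b : Fin m, (jordanBlock m z - algebraMap ℂ _ z : Matrix _ _ ℂ) a b
          = if (a : ℕ) = b + 1 then 1 else 0 := by
        intro a b
        by_cases hab : a = b
        · subst hab; simp [jordanBlock, Matrix.algebraMap_matrix_apply]
        · simp [jordanBlock, Matrix.algebraMap_matrix_apply, hab]
      simp only [ih, hN]
      by_cases hij : (i : ℕ) = j + (k + 1)
      · rw [if_pos hij, Finset.sum_eq_single (⟨j + 1, by omega⟩ : Fin m)]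
        · simp; omega
        · intro b _ hb
          have : (b : ℕ) ≠ j + 1 := fun h => hb (Fin.ext h)
          simp [this]
        · simp
      · rw [if_neg hij]
        refine Finset.sum_eq_zero fun b _ => ?_
        by_cases h : (b : ℕ) = j + 1
        · rw [if_neg (by omega)]; simp
        · simp [h]
  conv_lhs => rw [← sum_taylor_eq p z]
  rw [Polynomial.sum_def, map_sum, Matrix.sum_apply]
  have hterm : ∀ k : ℕ, (aeval (jordanBlock m z) (C ((taylor z p).coeff k) * (X - C z) ^ k)) i j
      = if (i : ℕ) = j + k then (taylor z p).coeff k else 0 := by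
    intro k
    rw [map_mul, map_pow, map_sub, aeval_X, aeval_C, aeval_C, ← Algebra.smul_def,
      Matrix.smul_apply, hpow]
    simp
  simp only [hterm]
  by_cases hji : j ≤ i
  · rw [if_pos hji]
    have hle : (j : ℕ) ≤ i := hji
    rw [Finset.sum_eq_single (i - j : ℕ)]
    · rw [if_pos (by omega)]
    · intro b _ hb; rw [if_neg (by omega)]
    · intro h; rw [if_pos (by omega)]; simpa using h
  · rw [if_neg hji]
    have hlt : ¬ (j : ℕ) ≤ i := hji
    exact Finset.sum_eq_zero fun b _ => by rw [if_neg (by omega)]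

theorem aeval_blockDiagonal {k : ℕ} {m : Fin k → ℕ}
    (M : ∀ a, Matrix (Fin (m a)) (Fin (m a)) ℂ) (p : ℂ[X]) :
    aeval (Matrix.blockDiagonal' M) p = Matrix.blockDiagonal' fun a => aeval (M a) p := by
  induction p using Polynomial.induction_on' with
  | add p q hp hq =>
    rw [map_add, hp, hq, ← Matrix.blockDiagonal'_add]
    congr 1; funext a; simp
  | monomial j c =>
    simp only [aeval_monomial, ← Algebra.smul_def, ← Matrix.blockDiagonal'_pow,
      ← Matrix.blockDiagonal'_smul]
    congr 1

/-- The primary matrix function in terms of a Jordan form `P J P⁻¹` of the matrix. -/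
theorem primaryMatrixFun_jordan {n k : ℕ} (f : ℂ → ℂ) (m : Fin k → ℕ) (z : Fin k → ℂ)
    (e : (Σ a, Fin (m a)) ≃ Fin n) (P : Matrix (Fin n) (Fin n) ℂ) (hP : IsUnit P.det) :
    primaryMatrixFun f
        (P * Matrix.reindex e e (Matrix.blockDiagonal' fun a => jordanBlock (m a) (z a)) * P⁻¹)
      = P * Matrix.reindex e e (Matrix.blockDiagonal' fun a => jordanBlockFun f (m a) (z a))
          * P⁻¹ := by
  set J := Matrix.reindex e e (Matrix.blockDiagonal' fun a => jordanBlock (m a) (z a)) with hJ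
  set Λ := P * J * P⁻¹ with hΛ
  have hPu : IsUnit P := (Matrix.isUnit_iff_isUnit_det P).2 hP
  have hconj : ∀ q : ℂ[X], aeval Λ q = P * aeval J q * P⁻¹ := by
    intro q
    induction q using Polynomial.induction_on' with
    | add p q hp hq => rw [map_add, map_add, hp, hq, mul_add, add_mul]
    | monomial j c =>
      have hpow : Λ ^ j = P * J ^ j * P⁻¹ := by
        induction j with
        | zero => simp [Matrix.mul_nonsing_inv P hP]
        | succ j ih =>
          rw [pow_succ, ih, hΛ, pow_succ]
          simp only [mul_assoc]
          rw [← mul_assoc P⁻¹ P, Matrix.nonsing_inv_mul P hP, one_mul]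
      rw [aeval_monomial, aeval_monomial, hpow, ← Algebra.smul_def, ← Algebra.smul_def]
      simp
  have hJq : ∀ q : ℂ[X], aeval J q = Matrix.reindex e e
      (Matrix.blockDiagonal' fun a => aeval (jordanBlock (m a) (z a)) q) := by
    intro q
    rw [← aeval_blockDiagonal]
    exact (aeval_algHom_apply (Matrix.reindexAlgEquiv ℂ ℂ e).toAlgHom _ q)
  have hμ : minpoly ℂ Λ ≠ 0 := minpoly.ne_zero (Matrix.isIntegral Λ)
  have hzero : aeval J (minpoly ℂ Λ) = 0 := by
    have h := hconj (minpoly ℂ Λ)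
    rw [minpoly.aeval] at h
    have h' : P⁻¹ * (P * aeval J (minpoly ℂ Λ) * P⁻¹) * P = 0 := by rw [← h]; simp
    simpa [← mul_assoc, Matrix.nonsing_inv_mul P hP, mul_assoc _ P⁻¹ P] using h'
  have hmult : ∀ (a : Fin k) (j : ℕ), j < m a → j < (minpoly ℂ Λ).rootMultiplicity (z a) := by
    intro a j hj
    refine (lt_rootMultiplicity_iff_isRoot_iterate_derivative hμ).2 fun l hl => ?_
    rw [IsRoot.def, iterate_derivative_eval_eq]
    have h := hJq (minpoly ℂ Λ)
    rw [hzero] at h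
    have h2 := congrFun (congrFun h (e ⟨a, ⟨l, by omega⟩⟩)) (e ⟨a, ⟨0, by omega⟩⟩)
    simp only [Matrix.reindex_apply, Matrix.submatrix_apply, Equiv.symm_apply_apply,
      Matrix.blockDiagonal'_apply_eq, aeval_jordanBlock, Matrix.zero_apply] at h2
    rw [if_pos (Fin.mk_le_mk.2 (Nat.zero_le l)), Nat.sub_zero] at h2
    rw [← h2, mul_zero]
  have hq : Interpolates f Λ (exists_interpolates f Λ).choose :=
    (exists_interpolates f Λ).choose_spec
  rw [primaryMatrixFun, hconj, hJq]
  congr 4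
  funext a
  ext i j
  rw [aeval_jordanBlock, jordanBlockFun]
  split_ifs with hji
  · have hj : ((i : ℕ) - (j : ℕ)) < m a := by omega
    have hm := hmult a _ hj
    have hz : z a ∈ (minpoly ℂ Λ).roots := by
      classical
      rw [← Multiset.count_pos, count_roots]; omega
    have h := hq (z a) hz _ hm
    rw [iterate_derivative_eval_eq] at h
    have hj0 : (((i : ℕ) - (j : ℕ)) ! : ℂ) ≠ 0 := by
      exact_mod_cast Nat.factorial_ne_zero _
    rw [← h]
    field_simp
  · rfl

/-! ### The kernels and the Fourier transform -/

/-- The power `x ^ D = exp (log x • D)` of a nonnegative real number `x` with matrix exponent `D`,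
with the convention that it is `0` for `x = 0`. -/
def realPow {n : ℕ} (x : ℝ) (D : Matrix (Fin n) (Fin n) ℂ) : Matrix (Fin n) (Fin n) ℂ :=
  if x = 0 then 0 else NormedSpace.exp ((Real.log x : ℂ) • D)

/-- For `s = 1` the positive part `x₊ = max {x, 0}`, for `s = -1` the negative part
`x₋ = max {-x, 0}`. -/
def signedPart (s x : ℝ) : ℝ := max (s * x) 0

/-- The kernel `u ↦ (t - u)_±^D - (-u)_±^D`, with `s = 1` for the sign `+` and `s = -1` for
the sign `-`. -/
def kernel {n : ℕ} (s : ℝ) (D : Matrix (Fin n) (Fin n) ℂ) (t u : ℝ) : Matrix (Fin n) (Fin n) ℂ :=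
  realPow (signedPart s (t - u)) D - realPow (signedPart s (-u)) D

/-- The function `± (e^{itx} - 1)/(ix) |x|^{-D} Γ(D+I) e^{∓ sign(x) iπD/2}`, with `s = 1` for the
upper signs and `s = -1` for the lower signs. -/
def kernelTransform {n : ℕ} (s : ℝ) (D : Matrix (Fin n) (Fin n) ℂ) (t x : ℝ) :
    Matrix (Fin n) (Fin n) ℂ :=
  ((s : ℂ) * ((Complex.exp (Complex.I * t * x) - 1) / (Complex.I * x))) •
    (realPow |x| (-D) * primaryMatrixFun Complex.Gamma (D + 1) *
      NormedSpace.exp ((-(s * Real.sign x : ℝ) * Complex.I * Real.pi / 2 : ℂ) • D))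

/-- The Fourier transform `x ↦ ∫ e^{iux} g(u) du` of a square integrable function, in the sense of
`L²(ℝ)`. Mathlib's Fourier transform has the kernel `e^{-2πiuξ}`, so `ξ = -x/(2π)`. -/
def fourierL2 (g : ℝ → ℂ) (hg : MemLp g 2 volume) (x : ℝ) : ℂ :=
  (𝓕 (hg.toLp g) : Lp ℂ 2 (volume : Measure ℝ)) (-x / (2 * Real.pi))

end OFBM

end

/-! Everything reduces to scalars. An entry of a primary matrix function of `D + 1` is a linear
combination of the derivatives of the stem function on the spectrum, with coefficients independent
of that function (`exists_primaryMatrixFun_apply_eq_sum`). Matrix exponentials are primary functions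
and primary functions multiply, so the kernel and its claimed transform are the same combination of
scalar pairs: (log v)^j v^(z-1) on v > 0, and the j-th z-derivative of e^(-lz) Γ(z) at l = log(isx),
times e^(itx) - 1 (`kernel_apply`, `kernelTransform_apply`). Here z is a characteristic root of H
plus 1/2.

The scalar identity is Euler's integral ∫ v^(z-1) e^(-rv) dv = r^(-z) Γ(z), differentiated j times
in z (`mellin_logExp_eq`). At r = isx it does not converge absolutely, so the kernel is damped by
e^(-εv), which replaces r by ε + isx, and ε tends to 0. The zero of e^(itx) - 1 at x = 0 tempers
|x|^(-Re z), and for 1/2 < Re z < 3/2 the transforms are dominated in L² uniformly in ε; Plancherel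
then carries the limit back to the kernel (`hasFourierL2_of_tendsto`).

If Re z < 1, the mean value inequality makes the scalar kernel integrable, and continuity upgrades
the almost everywhere identity to all x ≠ 0 (`integral_logKernel`). -/

noncomputable section

namespace OFBM

/-! ### Functional calculus -/

/-- The pairs `(z, j)` with `z` a root of the minimal polynomial of `Λ` and `j` smaller than its
multiplicity. -/
def spectralIndex {n : ℕ} (Λ : Matrix (Fin n) (Fin n) ℂ) : Finset (Σ _ : ℂ, ℕ) :=
  (minpoly ℂ Λ).roots.toFinset.sigma fun z => Finset.range ((minpoly ℂ Λ).rootMultiplicity z)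

theorem interpolates_iff {n : ℕ} (f : ℂ → ℂ) (Λ : Matrix (Fin n) (Fin n) ℂ) (p : ℂ[X]) :
    Interpolates f Λ p ↔
      ∀ i ∈ spectralIndex Λ, (derivative^[i.2] p).eval i.1 = iteratedDeriv i.2 f i.1 := by
  constructor
  · rintro h ⟨z, j⟩ hi
    simp only [spectralIndex, Finset.mem_sigma, Multiset.mem_toFinset, Finset.mem_range] at hi
    exact h z hi.1 j hi.2
  · intro h z hz j hj
    exact h ⟨z, j⟩ (by
      simp only [spectralIndex, Finset.mem_sigma, Multiset.mem_toFinset, Finset.mem_range]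
      exact ⟨hz, hj⟩)

theorem iteratedDeriv_polynomial_eval (p : ℂ[X]) (j : ℕ) :
    iteratedDeriv j (fun z => p.eval z) = fun z => (derivative^[j] p).eval z := by
  induction j with
  | zero => simp
  | succ j ih =>
    rw [iteratedDeriv_succ, ih, Function.iterate_succ_apply']
    ext z
    rw [Polynomial.deriv]

theorem interpolates_eval {n : ℕ} (Λ : Matrix (Fin n) (Fin n) ℂ) (p : ℂ[X]) :
    Interpolates (fun z => p.eval z) Λ p := fun z _ j _ => by
  rw [iteratedDeriv_polynomial_eval]

theorem primaryMatrixFun_eval {n : ℕ} (Λ : Matrix (Fin n) (Fin n) ℂ) (p : ℂ[X]) :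
    primaryMatrixFun (fun z => p.eval z) Λ = aeval Λ p :=
  primaryMatrixFun_eq _ _ _ (interpolates_eval Λ p)

/-- The entries of a primary matrix function are fixed linear combinations of the values of the
stem function and of its derivatives on the spectrum. -/
theorem exists_primaryMatrixFun_apply_eq_sum {n : ℕ} (Λ : Matrix (Fin n) (Fin n) ℂ)
    (a b : Fin n) : ∃ c : (Σ _ : ℂ, ℕ) → ℂ, ∀ f : ℂ → ℂ,
      primaryMatrixFun f Λ a b = ∑ i ∈ spectralIndex Λ, c i * iteratedDeriv i.2 f i.1 := by
  classical
  let E : spectralIndex Λ → ℂ[X] →ₗ[ℂ] ℂ := fun i =>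
    (Polynomial.leval i.1.1) ∘ₗ ((derivative : ℂ[X] →ₗ[ℂ] ℂ[X]) ^ i.1.2)
  have hE : ∀ i p, E i p = (derivative^[i.1.2] p).eval i.1.1 := fun i p => by
    simp [E, Module.End.pow_apply, Polynomial.leval]
  let K : ℂ[X] →ₗ[ℂ] ℂ :=
    { toFun := fun p => aeval Λ p a b
      map_add' := fun p q => by simp
      map_smul' := fun r p => by simp }
  have hK : K ∈ Submodule.span ℂ (Set.range E) := by
    -- A functional vanishing on the common kernel of finitely many functionals lies in their span.
    -- A polynomial killed by every `E i` interpolates the zero function, so its value at `Λ` is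
    -- zero.
    refine mem_span_of_iInf_ker_le_ker fun p hp => ?_
    simp only [Submodule.mem_iInf, LinearMap.mem_ker, hE] at hp ⊢
    have h0 : Interpolates (fun z => (0 : ℂ[X]).eval z) Λ p := by
      rw [interpolates_iff]
      intro i hi
      rw [hp ⟨i, hi⟩, iteratedDeriv_polynomial_eval]
      simp
    have := primaryMatrixFun_eq _ _ _ h0
    rw [primaryMatrixFun_eval] at this
    change aeval Λ p a b = 0
    rw [← this]
    simp
  obtain ⟨c, hc⟩ := (Submodule.mem_span_range_iff_exists_fun ℂ).1 hK
  refine ⟨fun i => if h : i ∈ spectralIndex Λ then c ⟨i, h⟩ else 0, fun f => ?_⟩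
  obtain ⟨p, hp⟩ := exists_interpolates f Λ
  rw [primaryMatrixFun_eq f Λ p hp, ← Finset.sum_coe_sort (spectralIndex Λ)]
  change K p = _
  rw [← hc, LinearMap.sum_apply]
  refine Finset.sum_congr rfl fun i _ => ?_
  rw [LinearMap.smul_apply, hE, (interpolates_iff f Λ p).1 hp i i.2, smul_eq_mul]
  simp [i.2]

/-- By Leibniz's rule, the product of interpolating polynomials interpolates the product of the stem
functions. -/
theorem primaryMatrixFun_mul {n : ℕ} (Λ : Matrix (Fin n) (Fin n) ℂ) {f g : ℂ → ℂ}
    (hf : ∀ z ∈ (minpoly ℂ Λ).roots, AnalyticAt ℂ f z)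
    (hg : ∀ z ∈ (minpoly ℂ Λ).roots, AnalyticAt ℂ g z) :
    primaryMatrixFun (fun z => f z * g z) Λ = primaryMatrixFun f Λ * primaryMatrixFun g Λ := by
  obtain ⟨p, hp⟩ := exists_interpolates f Λ
  obtain ⟨q, hq⟩ := exists_interpolates g Λ
  rw [primaryMatrixFun_eq f Λ p hp, primaryMatrixFun_eq g Λ q hq, ← map_mul]
  refine primaryMatrixFun_eq _ _ _ fun z hz j hj => ?_
  rw [mul_comm p q, iterate_derivative_mul,
    iteratedDeriv_fun_mul (hf z hz).contDiffAt (hg z hz).contDiffAt, eval_finsetSum]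
  refine Finset.sum_congr rfl fun i hi => ?_
  have hi' : i ≤ j := Nat.lt_succ_iff.1 (Finset.mem_range.1 hi)
  rw [eval_smul, eval_mul, hp z hz i (by omega), hq z hz (j - i) (by omega), nsmul_eq_mul]
  ring

theorem iteratedDeriv_exp_mul (w : ℂ) (j : ℕ) :
    iteratedDeriv j (fun z : ℂ => Complex.exp (w * z)) =
      fun z => w ^ j * Complex.exp (w * z) := by
  rw [iteratedDeriv_comp_const_mul Complex.contDiff_exp, iteratedDeriv_eq_iterate,
    Complex.iter_deriv_exp]

/-- Termwise differentiation of the exponential series: the terms of degree below j vanish, and an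
index shift by j turns the rest into w^j times the same series. -/
theorem hasSum_iteratedDeriv_exp_mul (w z : ℂ) (j : ℕ) :
    HasSum (fun k : ℕ => w ^ k / (k ! : ℂ) * (derivative^[j] (X ^ k : ℂ[X])).eval z)
      (w ^ j * Complex.exp (w * z)) := by
  rw [← hasSum_nat_add_iff' j]
  have h0 : ∑ k ∈ Finset.range j,
      w ^ k / (k ! : ℂ) * (derivative^[j] (X ^ k : ℂ[X])).eval z = 0 := by
    refine Finset.sum_eq_zero fun k hk => ?_
    rw [iterate_derivative_X_pow_eq_smul, Nat.descFactorial_of_lt (Finset.mem_range.1 hk)]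
    simp
  rw [h0, sub_zero]
  have h := (NormedSpace.expSeries_div_hasSum_exp (w * z)).mul_left (w ^ j)
  rw [← Complex.exp_eq_exp_ℂ] at h
  convert! h using 2 with k
  rw [iterate_derivative_X_pow_eq_smul, Nat.add_sub_cancel]
  have h1 : ((k + j).descFactorial j : ℂ) * (k ! : ℂ) = ((k + j)! : ℂ) := by
    rw [mul_comm]
    exact_mod_cast (by simpa using Nat.factorial_mul_descFactorial (Nat.le_add_left j k))
  have h2 : ((k + j)! : ℂ) ≠ 0 := by exact_mod_cast Nat.factorial_ne_zero _
  have h3 : (k ! : ℂ) ≠ 0 := by exact_mod_cast Nat.factorial_ne_zero _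
  simp only [eval_smul, eval_pow, eval_X]
  rw [← h1] at h2 ⊢
  have h4 := left_ne_zero_of_mul h2
  field_simp
  ring

/-- The entry formula applied to the stem functions X^k matches the two series term by term. -/
theorem exp_smul_eq_primaryMatrixFun {n : ℕ} (Λ : Matrix (Fin n) (Fin n) ℂ) (w : ℂ) :
    NormedSpace.exp (w • Λ) = primaryMatrixFun (fun z => Complex.exp (w * z)) Λ := by
  ext a b
  obtain ⟨c, hc⟩ := exists_primaryMatrixFun_apply_eq_sum Λ a b
  have h1 : HasSum (fun k : ℕ => ((k ! : ℂ)⁻¹ • (w • Λ) ^ k) a b)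
      (NormedSpace.exp (w • Λ) a b) := by
    let : NormedRing (Matrix (Fin n) (Fin n) ℂ) := Matrix.linftyOpNormedRing
    let : NormedAlgebra ℂ (Matrix (Fin n) (Fin n) ℂ) := Matrix.linftyOpNormedAlgebra
    have h := NormedSpace.exp_series_hasSum_exp' (𝕂 := ℂ) (w • Λ)
    exact Pi.hasSum.1 (Pi.hasSum.1 h a) b
  have h2 : HasSum (fun k : ℕ => ∑ i ∈ spectralIndex Λ,
      c i * (w ^ k / (k ! : ℂ) * (derivative^[i.2] (X ^ k : ℂ[X])).eval i.1))
      (∑ i ∈ spectralIndex Λ, c i * (w ^ i.2 * Complex.exp (w * i.1))) :=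
    hasSum_sum fun i _ => (hasSum_iteratedDeriv_exp_mul w i.1 i.2).mul_left _
  rw [hc]
  simp only [iteratedDeriv_exp_mul]
  refine h1.unique ?_
  convert h2 using 2 with k
  have h3 := hc (fun z => (X ^ k : ℂ[X]).eval z)
  rw [primaryMatrixFun_eval, map_pow, aeval_X] at h3
  rw [_root_.smul_pow, smul_smul, Matrix.smul_apply, h3, smul_eq_mul, Finset.mul_sum]
  refine Finset.sum_congr rfl fun i _ => ?_
  rw [iteratedDeriv_polynomial_eval]
  ring

open Filter
open scoped Topology ENNReal

/-! ### The Fourier transform of square integrable functions -/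

theorem ae_comp_neg_div_two_pi {p : ℝ → Prop} (h : ∀ᵐ ξ : ℝ, p ξ) :
    ∀ᵐ x : ℝ, p (-x / (2 * Real.pi)) := by
  have hne : (-(2 * Real.pi)⁻¹ : ℝ) ≠ 0 := by
    simp [Real.pi_ne_zero]
  have hq : Measure.QuasiMeasurePreserving (fun x : ℝ => -(2 * Real.pi)⁻¹ * x) volume volume := by
    refine ⟨by fun_prop, ?_⟩
    rw [Real.map_volume_mul_left hne]
    exact Measure.smul_absolutelyContinuous
  filter_upwards [hq.ae h] with x hx
  convert! hx using 1
  ring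

/-- On `L¹ ∩ L²` the Fourier transform in the sense of `L²` is given by the Fourier integral. -/
theorem fourier_toLp_ae_eq {g : ℝ → ℂ} (hint : Integrable g) (hg : MemLp g 2 volume) :
    (𝓕 (hg.toLp g) : Lp ℂ 2 (volume : Measure ℝ)) =ᵐ[volume] 𝓕 g := by
  have hcont : Continuous (𝓕 g) :=
    VectorFourier.fourierIntegral_continuous Real.continuous_fourierChar (by fun_prop) hint
  refine ae_eq_of_integral_contDiff_smul_eq
    ((Lp.memLp _).locallyIntegrable (by norm_num)) hcont.locallyIntegrable fun ψ hψ hψc => ?_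
  have hc : HasCompactSupport (fun x => (ψ x : ℂ)) := hψc.comp_left (g := Complex.ofReal) (by simp)
  have hs : ContDiff ℝ (⊤ : ℕ∞) (fun x => (ψ x : ℂ)) := Complex.ofRealCLM.contDiff.comp hψ
  let η : SchwartzMap ℝ ℂ := hc.toSchwartzMap hs
  have hη : ∀ x, η x = (ψ x : ℂ) := fun x => rfl
  -- As a tempered distribution, the L² transform is tested by moving 𝓕 onto `η`; for integrable `g`
  -- the Fourier integral obeys the same rule (`h3`).
  have h1 := congrArg (fun T => T η) (Lp.fourier_toTemperedDistribution_eq (hg.toLp g))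
  simp only [TemperedDistribution.fourier_apply, Lp.toTemperedDistribution_apply] at h1
  have h2 : ∫ x, (𝓕 η) x • (hg.toLp g : ℝ → ℂ) x = ∫ x, (𝓕 η) x • g x :=
    integral_congr_ae (by filter_upwards [hg.coeFn_toLp] with x hx; rw [hx])
  have h3 : ∫ x, (𝓕 (η : ℝ → ℂ)) x • g x = ∫ x, η x • (𝓕 g : ℝ → ℂ) x := by
    simpa using! (VectorFourier.integral_fourierIntegral_smul_eq_flip (L := innerₗ ℝ)
      Real.continuous_fourierChar continuous_inner (η.integrable (μ := volume)) hint)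
  calc ∫ x, ψ x • (𝓕 (hg.toLp g) : Lp ℂ 2 (volume : Measure ℝ)) x
      = ∫ x, η x • (𝓕 (hg.toLp g) : Lp ℂ 2 (volume : Measure ℝ)) x := by
        simp [hη]
    _ = ∫ x, η x • (𝓕 g : ℝ → ℂ) x := by
        rw [← h1, h2, ← h3]
        rfl
    _ = ∫ x, ψ x • (𝓕 g : ℝ → ℂ) x := by
        simp [hη]

theorem fourier_neg_div_two_pi (g : ℝ → ℂ) (x : ℝ) :
    𝓕 g (-x / (2 * Real.pi)) = ∫ u : ℝ, Complex.exp (Complex.I * u * x) * g u := by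
  rw [Real.fourier_eq']
  refine integral_congr_ae (Eventually.of_forall fun u => ?_)
  simp only [smul_eq_mul]
  congr 2
  have : (Real.pi : ℂ) ≠ 0 := by exact_mod_cast Real.pi_ne_zero
  simp
  field_simp

/-- The function `g` is square integrable with Fourier transform `m`, in the sense of `L²`. -/
def HasFourierL2 (g m : ℝ → ℂ) : Prop :=
  ∃ hg : MemLp g 2 volume, ∀ᵐ x : ℝ, fourierL2 g hg x = m x

theorem hasFourierL2_of_ae_eq {g m : ℝ → ℂ} (hg : MemLp g 2 volume)
    (h : (𝓕 (hg.toLp g) : Lp ℂ 2 (volume : Measure ℝ)) =ᵐ[volume]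
      fun ξ => m (-(2 * Real.pi) * ξ)) : HasFourierL2 g m := by
  refine ⟨hg, ?_⟩
  filter_upwards [ae_comp_neg_div_two_pi h] with x hx
  rw [fourierL2, hx]
  congr 1
  have := Real.pi_ne_zero
  field_simp

theorem HasFourierL2.ae_eq_integral {g m : ℝ → ℂ} (h : HasFourierL2 g m) (hint : Integrable g) :
    ∀ᵐ x : ℝ, ∫ u : ℝ, Complex.exp (Complex.I * u * x) * g u = m x := by
  obtain ⟨hg, h⟩ := h
  filter_upwards [h, ae_comp_neg_div_two_pi (fourier_toLp_ae_eq hint hg)] with x h1 h2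
  rw [← h1, fourierL2, h2, fourier_neg_div_two_pi]

theorem HasFourierL2.const_mul {g m : ℝ → ℂ} (h : HasFourierL2 g m) (c : ℂ) :
    HasFourierL2 (fun u => c * g u) (fun x => c * m x) := by
  obtain ⟨hg, h⟩ := h
  refine ⟨hg.const_mul c, ?_⟩
  have h1 : (hg.const_mul c).toLp (fun u => c * g u) = c • hg.toLp g := rfl
  filter_upwards [h, ae_comp_neg_div_two_pi (Lp.coeFn_smul c
    (𝓕 (hg.toLp g) : Lp ℂ 2 (volume : Measure ℝ)))] with x h2 h3
  rw [fourierL2, h1, FourierTransform.fourier_smul, h3, ← h2]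
  rfl

theorem HasFourierL2.add {g₁ g₂ m₁ m₂ : ℝ → ℂ} (h₁ : HasFourierL2 g₁ m₁)
    (h₂ : HasFourierL2 g₂ m₂) :
    HasFourierL2 (fun u => g₁ u + g₂ u) (fun x => m₁ x + m₂ x) := by
  obtain ⟨hg₁, h₁⟩ := h₁
  obtain ⟨hg₂, h₂⟩ := h₂
  refine ⟨hg₁.add hg₂, ?_⟩
  have h : (hg₁.add hg₂).toLp (fun u => g₁ u + g₂ u) = hg₁.toLp g₁ + hg₂.toLp g₂ := rfl
  filter_upwards [h₁, h₂, ae_comp_neg_div_two_pi (Lp.coeFn_add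
    (𝓕 (hg₁.toLp g₁) : Lp ℂ 2 (volume : Measure ℝ)) (𝓕 (hg₂.toLp g₂)))] with x h3 h4 h5
  rw [fourierL2, h, FourierTransform.fourier_add, h5, ← h3, ← h4]
  rfl

theorem hasFourierL2_zero : HasFourierL2 (fun _ => 0) (fun _ => 0) := by
  have hg : MemLp (fun _ : ℝ => (0 : ℂ)) 2 volume := MemLp.zero
  simpa using HasFourierL2.const_mul (g := fun _ => 0) (m := fourierL2 _ hg)
    ⟨hg, Eventually.of_forall fun _ => rfl⟩ 0

theorem HasFourierL2.sum {ι : Type*} (S : Finset ι) {g m : ι → ℝ → ℂ}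
    (h : ∀ i ∈ S, HasFourierL2 (g i) (m i)) :
    HasFourierL2 (fun u => ∑ i ∈ S, g i u) (fun x => ∑ i ∈ S, m i x) := by
  classical
  induction S using Finset.induction_on with
  | empty => simpa using hasFourierL2_zero
  | insert i S hi ih =>
    simp only [Finset.sum_insert hi]
    exact (h i (Finset.mem_insert_self i S)).add
      (ih fun j hj => h j (Finset.mem_insert_of_mem hj))

/-- Dominated convergence for the squared difference, with majorant (2B)², since the limit inherits
the bound B. -/
theorem tendsto_eLpNorm_two_of_dominated {α : Type*} [MeasurableSpace α] {μ : Measure α}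
    {f : ℕ → α → ℂ} {g : α → ℂ} {B : α → ℝ} (hf : ∀ N, AEStronglyMeasurable (f N) μ)
    (hB : MemLp B 2 μ) (hfB : ∀ N, ∀ᵐ x ∂μ, ‖f N x‖ ≤ B x)
    (hlim : ∀ᵐ x ∂μ, Tendsto (fun N => f N x) atTop (𝓝 (g x))) :
    MemLp g 2 μ ∧ Tendsto (fun N => eLpNorm (f N - g) 2 μ) atTop (𝓝 0) := by
  have hgm : AEStronglyMeasurable g μ := aestronglyMeasurable_of_tendsto_ae atTop hf hlim
  have hgB : ∀ᵐ x ∂μ, ‖g x‖ ≤ B x := by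
    filter_upwards [hlim, ae_all_iff.2 hfB] with x h1 h2
    exact le_of_tendsto h1.norm (Eventually.of_forall h2)
  refine ⟨hB.mono' hgm hgB, ?_⟩
  have h2B : MemLp (fun x => 2 * B x) 2 μ := hB.const_mul 2
  have hfin := (eLpNorm_lt_top_iff_lintegral_rpow_enorm_lt_top (by norm_num) (by norm_num)).1
    h2B.eLpNorm_lt_top
  have h := tendsto_lintegral_of_dominated_convergence' (μ := μ)
    (F := fun N x => ‖(f N - g) x‖ₑ ^ (2 : ℝ≥0∞).toReal) (f := fun _ => 0)
    (fun x => ‖2 * B x‖ₑ ^ (2 : ℝ≥0∞).toReal)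
    (fun N => ((hf N).sub hgm).enorm.pow_const _) (fun N => by
      filter_upwards [hfB N, hgB] with x h1 h2
      gcongr
      rw [enorm_le_iff_norm_le, Real.norm_eq_abs]
      refine le_trans (norm_sub_le _ _) (le_trans ?_ (le_abs_self _))
      linarith) hfin.ne (by
      filter_upwards [hlim] with x hx
      have h1 : Tendsto (fun N => ‖f N x - g x‖ₑ) atTop (𝓝 0) := by
        simpa using (hx.sub_const (g x)).enorm
      simpa using ENNReal.Tendsto.pow (n := 2) h1)
  simp only [eLpNorm_eq_lintegral_rpow_enorm_toReal (p := 2) (by norm_num) (by norm_num)]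
  rw [lintegral_zero] at h
  have h3 := (ENNReal.continuous_rpow_const (y := 1 / (2 : ℝ≥0∞).toReal)).tendsto 0 |>.comp h
  simpa [Function.comp_def] using h3

/-- If integrable and square integrable functions converge almost everywhere, and their Fourier
transforms are dominated in `L²` and converge almost everywhere, then the first limit is square
integrable and its Fourier transform is the second limit. -/
theorem hasFourierL2_of_tendsto {g : ℕ → ℝ → ℂ} {m : ℕ → ℝ → ℂ} {g₀ m₀ : ℝ → ℂ} {B : ℝ → ℝ}
    (hint : ∀ N, Integrable (g N)) (hmem : ∀ N, MemLp (g N) 2 volume)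
    (hm : ∀ (N : ℕ) (x : ℝ), ∫ u : ℝ, Complex.exp (Complex.I * u * x) * g N u = m N x)
    (hB : MemLp B 2 volume) (hmB : ∀ N x, x ≠ 0 → ‖m N x‖ ≤ B x)
    (hmlim : ∀ x ≠ 0, Tendsto (fun N => m N x) atTop (𝓝 (m₀ x)))
    (hglim : ∀ᵐ u : ℝ, Tendsto (fun N => g N u) atTop (𝓝 (g₀ u))) :
    HasFourierL2 g₀ m₀ := by
  have hpi : (-(2 * Real.pi)) ≠ 0 := by simp [Real.pi_ne_zero]
  have hF : ∀ N ξ, 𝓕 (g N) ξ = m N (-(2 * Real.pi) * ξ) := fun N ξ => by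
    rw [← hm, ← fourier_neg_div_two_pi]
    field_simp
  have hcont : ∀ N, Continuous (𝓕 (g N)) := fun N =>
    VectorFourier.fourierIntegral_continuous Real.continuous_fourierChar (by fun_prop) (hint N)
  have hB' : MemLp (fun ξ => B (-(2 * Real.pi) * ξ)) 2 volume := by
    have hq : Measure.QuasiMeasurePreserving (fun x : ℝ => -(2 * Real.pi) * x) volume volume := by
      refine ⟨by fun_prop, ?_⟩
      rw [Real.map_volume_mul_left hpi]
      exact Measure.smul_absolutelyContinuous
    refine (memLp_two_iff_integrable_sq
      (hB.aestronglyMeasurable.comp_quasiMeasurePreserving hq)).2 ?_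
    exact ((memLp_two_iff_integrable_sq hB.aestronglyMeasurable).1 hB).comp_mul_left' hpi
  have hne : ∀ᵐ ξ : ℝ, ξ ≠ 0 := by simp [ae_iff]
  obtain ⟨hm₀, hlim⟩ := tendsto_eLpNorm_two_of_dominated (μ := volume) (f := fun N => 𝓕 (g N))
    (g := fun ξ => m₀ (-(2 * Real.pi) * ξ)) (fun N => (hcont N).aestronglyMeasurable) hB'
    (fun N => by
      filter_upwards [hne] with ξ hξ
      rw [hF]
      exact hmB N _ (mul_ne_zero hpi hξ))
    (by
      filter_upwards [hne] with ξ hξ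
      simp only [hF]
      exact hmlim _ (mul_ne_zero hpi hξ))
  let G : ℕ → Lp ℂ 2 (volume : Measure ℝ) := fun N => (hmem N).toLp (g N)
  let M : Lp ℂ 2 (volume : Measure ℝ) := hm₀.toLp _
  have h1 : Tendsto (fun N => 𝓕 (G N)) atTop (𝓝 M) := by
    refine Lp.tendsto_Lp_of_tendsto_eLpNorm _ hm₀ (hlim.congr fun N => eLpNorm_congr_ae ?_)
    exact (fourier_toLp_ae_eq (hint N) (hmem N)).symm.sub EventuallyEq.rfl
  -- Plancherel: the inverse transform is an isometry, so no domination of the functions `g N`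
  -- themselves is needed.
  have h2 : Tendsto G atTop (𝓝 (𝓕⁻ M)) := by
    have := (Lp.fourierTransformₗᵢ ℝ ℂ).symm.continuous.tendsto M |>.comp h1
    refine this.congr fun N => ?_
    exact (Lp.fourierTransformₗᵢ ℝ ℂ).symm_apply_apply (G N)
  have h3 := tendstoInMeasure_of_tendsto_Lp h2
  -- An almost everywhere convergent subsequence identifies the L² limit with `g₀`, which is how
  -- `g₀` is seen to be square integrable.
  obtain ⟨ns, hns, h4⟩ := h3.exists_seq_tendsto_ae
  have h5 : (𝓕⁻ M : Lp ℂ 2 (volume : Measure ℝ)) =ᵐ[volume] g₀ := by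
    filter_upwards [h4, hglim, ae_all_iff.2 fun N => (hmem N).coeFn_toLp] with u hu1 hu2 hu3
    refine tendsto_nhds_unique hu1 ((hu2.comp hns.tendsto_atTop).congr fun N => ?_)
    exact (hu3 (ns N)).symm
  have hg₀ : MemLp g₀ 2 volume := (Lp.memLp _).ae_eq h5
  have h6 : hg₀.toLp g₀ = 𝓕⁻ M := by
    rw [← Lp.toLp_coeFn (𝓕⁻ M) (Lp.memLp _)]
    exact MemLp.toLp_congr _ _ h5.symm
  refine hasFourierL2_of_ae_eq hg₀ ?_
  rw [h6, FourierTransform.fourier_fourierInv_eq]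
  exact hm₀.coeFn_toLp

open Asymptotics Set

/-! ### Mellin transforms of exponentials with logarithmic factors -/

/-- The function `t ↦ (log t) ^ j * e ^ (-r t)`. -/
def logExp (r : ℂ) (j : ℕ) (t : ℝ) : ℂ := (Real.log t : ℂ) ^ j * Complex.exp (-(r * t))

theorem log_smul_logExp (r : ℂ) (j : ℕ) :
    (fun t : ℝ => Real.log t • logExp r j t) = logExp r (j + 1) := by
  ext t
  simp only [logExp, Complex.real_smul]
  ring

theorem norm_exp_neg_mul_ofReal (r : ℂ) (t : ℝ) :
    ‖Complex.exp (-(r * t))‖ = Real.exp (-r.re * t) := by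
  rw [Complex.norm_exp]
  simp

/-- The exponent is generalized because each logarithm is paid for by a faster power decay of the
remaining factor. -/
theorem logExp_isBigO_atTop {r : ℂ} (hr : 0 < r.re) (j : ℕ) (a : ℝ) :
    logExp r j =O[atTop] (fun t : ℝ => t ^ (-a)) := by
  induction j generalizing a with
  | zero =>
    refine IsBigO.trans (IsBigO.of_norm_le fun t => ?_)
      (isLittleO_exp_neg_mul_rpow_atTop hr (-a)).isBigO
    rw [logExp, pow_zero, one_mul, norm_exp_neg_mul_ofReal]
  | succ j ih =>
    rw [← log_smul_logExp]
    exact isBigO_rpow_top_log_smul (lt_add_one a) (ih (a + 1))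

theorem logExp_isBigO_zero {r : ℂ} (hr : 0 < r.re) (j : ℕ) {b : ℝ} (hb : 0 < b) :
    logExp r j =O[𝓝[>] 0] (fun t : ℝ => t ^ (-b)) := by
  induction j generalizing b with
  | zero =>
    refine IsBigO.of_bound 1 ?_
    filter_upwards [Ioo_mem_nhdsGT zero_lt_one] with t ht
    rw [logExp, pow_zero, one_mul, norm_exp_neg_mul_ofReal, one_mul]
    refine le_trans (Real.exp_le_one_iff.2 ?_) (le_trans ?_ (le_abs_self _))
    · nlinarith [ht.1]
    · exact Real.one_le_rpow_of_pos_of_le_one_of_nonpos ht.1 ht.2.le (by linarith)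
  | succ j ih =>
    rw [← log_smul_logExp]
    exact isBigO_rpow_zero_log_smul (half_lt_self hb) (ih (half_pos hb))

theorem continuousOn_logExp (r : ℂ) (j : ℕ) : ContinuousOn (logExp r j) (Ioi 0) := by
  have h : ContinuousOn (fun t : ℝ => (Real.log t : ℂ)) (Ioi 0) :=
    Complex.continuous_ofReal.comp_continuousOn
      (Real.continuousOn_log.mono fun t ht => ne_of_gt ht)
  exact (h.pow j).mul (by fun_prop)

theorem locallyIntegrableOn_logExp (r : ℂ) (j : ℕ) : LocallyIntegrableOn (logExp r j) (Ioi 0) :=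
  (continuousOn_logExp r j).locallyIntegrableOn measurableSet_Ioi

theorem mellin_logExp {r z : ℂ} (hr : 0 < r.re) (hz : 0 < z.re) (j : ℕ) :
    MellinConvergent (logExp r j) z ∧
      HasDerivAt (mellin (logExp r j)) (mellin (logExp r (j + 1)) z) z := by
  have hb : z.re / 2 < z.re := half_lt_self hz
  refine ⟨mellinConvergent_of_isBigO_rpow (locallyIntegrableOn_logExp r j)
    (logExp_isBigO_atTop hr j (z.re + 1)) (lt_add_one _)
    (logExp_isBigO_zero hr j (half_pos hz)) hb, ?_⟩
  have h := (mellin_hasDerivAt_of_isBigO_rpow (locallyIntegrableOn_logExp r j)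
    (logExp_isBigO_atTop hr j (z.re + 1)) (lt_add_one _)
    (logExp_isBigO_zero hr j (half_pos hz)) hb).2
  rwa [log_smul_logExp] at h

theorem isOpen_re_pos : IsOpen {z : ℂ | 0 < z.re} :=
  isOpen_lt continuous_const Complex.continuous_re

theorem iteratedDeriv_mellin_logExp {r z : ℂ} (hr : 0 < r.re) (hz : 0 < z.re) (j : ℕ) :
    iteratedDeriv j (mellin (logExp r 0)) z = mellin (logExp r j) z := by
  induction j generalizing z with
  | zero => simp
  | succ j ih =>
    rw [iteratedDeriv_succ]
    have h : iteratedDeriv j (mellin (logExp r 0)) =ᶠ[𝓝 z] mellin (logExp r j) := by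
      filter_upwards [isOpen_re_pos.mem_nhds hz] with w hw using ih hw
    rw [h.deriv_eq, (mellin_logExp hr hz j).2.deriv]

/-- Differentiation under the integral in the rate: it brings down a factor t, so on Re w > Re r / 2
the integrand at z + 1 with rate Re r / 2 is a majorant. -/
theorem differentiableAt_mellin_logExp_zero {r z : ℂ} (hr : 0 < r.re) (hz : 0 < z.re) :
    DifferentiableAt ℂ (fun r => mellin (logExp r 0) z) r := by
  have hr2 : 0 < ((r.re / 2 : ℝ) : ℂ).re := by simpa using half_pos hr
  have hcz : ∀ w : ℂ, ContinuousOn (fun t : ℝ => (t : ℂ) ^ w) (Ioi 0) := fun w =>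
    continuousOn_of_forall_continuousAt fun t ht =>
      Complex.continuousAt_ofReal_cpow_const _ _ (Or.inr (ne_of_gt ht))
  have hm : ∀ w : ℂ, AEStronglyMeasurable (fun t : ℝ => (t : ℂ) ^ (z - 1) • logExp w 0 t)
      (volume.restrict (Ioi 0)) := fun w =>
    ((hcz _).smul (continuousOn_logExp w 0)).aestronglyMeasurable measurableSet_Ioi
  have h := hasDerivAt_integral_of_dominated_loc_of_deriv_le
    (μ := volume.restrict (Ioi (0 : ℝ))) (𝕜 := ℂ)
    (F := fun w (t : ℝ) => (t : ℂ) ^ (z - 1) • logExp w 0 t)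
    (F' := fun w (t : ℝ) => (t : ℂ) ^ (z - 1) • (-(t : ℂ) * logExp w 0 t))
    (x₀ := r) (s := {w : ℂ | r.re / 2 < w.re})
    (bound := fun t : ℝ => ‖(t : ℂ) ^ ((z + 1) - 1) • logExp ((r.re / 2 : ℝ) : ℂ) 0 t‖)
    ((isOpen_lt continuous_const Complex.continuous_re).mem_nhds (half_lt_self hr))
    (Eventually.of_forall hm) (mellin_logExp hr hz 0).1
    (((hcz _).smul (ContinuousOn.mul (by fun_prop)
      (continuousOn_logExp r 0))).aestronglyMeasurable measurableSet_Ioi)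
    ?_ (mellin_logExp hr2 (by simp; linarith) 0).1.norm ?_
  · exact h.2.differentiableAt
  · filter_upwards [ae_restrict_mem measurableSet_Ioi] with t ht w hw
    have ht' : (0 : ℝ) < t := ht
    have ht0 : (t : ℂ) ≠ 0 := by exact_mod_cast ht'.ne'
    have h1 : (t : ℂ) ^ (z + 1 - 1) = (t : ℂ) ^ (z - 1) * t := by
      rw [add_sub_right_comm, Complex.cpow_add _ _ ht0, Complex.cpow_one]
    rw [h1]
    simp only [logExp, pow_zero, one_mul, norm_smul, norm_mul, norm_neg, mul_assoc,
      norm_exp_neg_mul_ofReal, Complex.ofReal_re]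
    gcongr
  · refine Eventually.of_forall fun t w _ => ?_
    refine HasDerivAt.fun_const_smul _ ?_
    have h1 : HasDerivAt (fun w : ℂ => -(w * t)) (-(t : ℂ)) w := by
      simpa using! ((hasDerivAt_id w).mul_const (t : ℂ)).neg
    simp only [logExp, pow_zero, one_mul]
    convert! h1.cexp using 1
    ring

/-- Euler's integral for real r > 0, extended to Re r > 0 by the identity theorem, since both sides
are holomorphic in r. -/
theorem mellin_logExp_zero {r z : ℂ} (hr : 0 < r.re) (hz : 0 < z.re) :
    mellin (logExp r 0) z = Complex.exp (-Complex.log r * z) * Complex.Gamma z := by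
  have hsl : ∀ w : ℂ, 0 < w.re → w ∈ Complex.slitPlane := fun w hw => Or.inl hw
  have h1 : AnalyticOnNhd ℂ (fun r => mellin (logExp r 0) z) {w : ℂ | 0 < w.re} :=
    DifferentiableOn.analyticOnNhd (fun w hw =>
      (differentiableAt_mellin_logExp_zero hw hz).differentiableWithinAt) isOpen_re_pos
  have h2 : AnalyticOnNhd ℂ (fun r => Complex.exp (-Complex.log r * z) * Complex.Gamma z)
      {w : ℂ | 0 < w.re} :=
    DifferentiableOn.analyticOnNhd (fun w hw => DifferentiableAt.differentiableWithinAt (by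
      have := (Complex.hasStrictDerivAt_log (hsl w hw)).hasDerivAt.differentiableAt
      fun_prop)) isOpen_re_pos
  have hconn : IsPreconnected {w : ℂ | 0 < w.re} :=
    (convex_halfSpace_re_gt 0).isPreconnected
  refine h1.eqOn_of_preconnected_of_frequently_eq h2 hconn (z₀ := 1) (by simp) ?_ hr
  have hreal : ∀ y : ℝ, 0 < y → mellin (logExp (y : ℂ) 0) z =
      Complex.exp (-Complex.log y * z) * Complex.Gamma z := fun y hy => by
    have h3 := Complex.integral_cpow_mul_exp_neg_mul_Ioi hz hy
    simp only [mellin, logExp, pow_zero, one_mul, smul_eq_mul]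
    rw [h3, Complex.cpow_def_of_ne_zero (by simpa using hy.ne'), one_div, Complex.log_inv]
    rw [Complex.arg_ofReal_of_nonneg hy.le]
    exact Real.pi_ne_zero.symm
  have htend : Tendsto (fun y : ℝ => (y : ℂ)) (𝓝[>] 1) (𝓝[≠] 1) := by
    refine tendsto_nhdsWithin_iff.2 ⟨?_, ?_⟩
    · exact (Complex.continuous_ofReal.tendsto' 1 1 (by simp)).mono_left nhdsWithin_le_nhds
    · filter_upwards [self_mem_nhdsWithin] with y hy
      simpa using ne_of_gt hy
  refine htend.frequently (Eventually.frequently ?_)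
  filter_upwards [self_mem_nhdsWithin] with y hy
  exact hreal y (lt_trans zero_lt_one hy)

/-- The `j`-th derivative at `z` of the function `z ↦ e ^ (-l z) Γ(z)`. -/
def expGammaDeriv (z : ℂ) (j : ℕ) (l : ℂ) : ℂ :=
  iteratedDeriv j (fun w => Complex.exp (-l * w) * Complex.Gamma w) z

theorem mellin_logExp_eq {r z : ℂ} (hr : 0 < r.re) (hz : 0 < z.re) (j : ℕ) :
    mellin (logExp r j) z = expGammaDeriv z j (Complex.log r) := by
  rw [← iteratedDeriv_mellin_logExp hr hz, expGammaDeriv]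
  refine Filter.EventuallyEq.iteratedDeriv_eq j ?_
  filter_upwards [isOpen_re_pos.mem_nhds hz] with w hw using mellin_logExp_zero hr hw

theorem analyticAt_Gamma {z : ℂ} (hz : 0 < z.re) : AnalyticAt ℂ Complex.Gamma z := by
  refine DifferentiableOn.analyticOnNhd (s := {z : ℂ | 0 < z.re}) (fun w hw => ?_)
    isOpen_re_pos z hz
  refine (Complex.differentiableAt_Gamma w fun m h => ?_).differentiableWithinAt
  have hw' : 0 < w.re := hw
  rw [h] at hw'
  simp at hw'
  linarith [(Nat.cast_nonneg m : (0 : ℝ) ≤ m)]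

/-- Leibniz's rule. Continuity and growth in l are read off from this form, a polynomial in l times
e^(-lz). -/
theorem expGammaDeriv_eq {z : ℂ} (hz : 0 < z.re) (j : ℕ) (l : ℂ) :
    expGammaDeriv z j l = ∑ i ∈ Finset.range (j + 1), (j.choose i : ℂ) *
      ((-l) ^ i * Complex.exp (-l * z)) * iteratedDeriv (j - i) Complex.Gamma z := by
  rw [expGammaDeriv, iteratedDeriv_fun_mul (by fun_prop) (analyticAt_Gamma hz).contDiffAt]
  simp only [iteratedDeriv_exp_mul]

theorem continuous_expGammaDeriv {z : ℂ} (hz : 0 < z.re) (j : ℕ) :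
    Continuous (expGammaDeriv z j) := by
  simp only [funext (expGammaDeriv_eq hz j)]
  fun_prop

/-! ### Bounds -/

/-- Compare with a single term of the series of exp(η(y + p)). The shift p leaves room for the
imaginary part of a complex logarithm, at most π. -/
theorem exists_add_pow_le_mul_exp (i : ℕ) (p : ℝ) (hp : 0 ≤ p) {η : ℝ} (hη : 0 < η) :
    ∃ K : ℝ, 0 ≤ K ∧ ∀ y : ℝ, 0 ≤ y → (y + p) ^ i ≤ K * Real.exp (η * y) := by
  refine ⟨(i ! : ℝ) / η ^ i * Real.exp (η * p), by positivity, fun y hy => ?_⟩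
  have h := Real.pow_div_factorial_le_exp (η * (y + p)) (by positivity) i
  rw [div_le_iff₀ (by positivity), mul_pow, mul_add, Real.exp_add] at h
  have h2 : (y + p) ^ i = (η ^ i * (y + p) ^ i) / η ^ i := by field_simp
  rw [h2, div_le_iff₀ (by positivity)]
  refine h.trans (le_of_eq ?_)
  field_simp

/-- The first power dominates for x ≥ 1, the second for x ≤ 1; the margin η on either side of c pays
for e^(η|log x|). -/
theorem exp_mul_log_add_le {a b c η : ℝ} (h1 : a + η ≤ c) (h2 : c + η ≤ b) {x : ℝ} (hx : 0 < x) :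
    Real.exp (-c * Real.log x + η * |Real.log x|) ≤ x ^ (-a) + x ^ (-b) := by
  rw [Real.rpow_def_of_pos hx, Real.rpow_def_of_pos hx]
  rcases le_total 0 (Real.log x) with h | h
  · rw [abs_of_nonneg h]
    refine le_add_of_le_of_nonneg (Real.exp_le_exp.2 ?_) (Real.exp_pos _).le
    nlinarith
  · rw [abs_of_nonpos h]
    refine le_add_of_nonneg_of_le (Real.exp_pos _).le (Real.exp_le_exp.2 ?_)
    nlinarith

/-- Since |arg r| ≤ π, r^(-z) has modulus at most e^(π|Im z|) ‖r‖^(-Re z); widening the exponent to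
a and b absorbs the powers of log r. The uniformity in r allows the damping to be removed later. -/
theorem exists_norm_expGammaDeriv_log_le {z : ℂ} (hz : 0 < z.re) (j : ℕ) {a b : ℝ}
    (ha : a < z.re) (hb : z.re < b) :
    ∃ C : ℝ, 0 ≤ C ∧ ∀ r : ℂ, r ≠ 0 →
      ‖expGammaDeriv z j (Complex.log r)‖ ≤ C * (‖r‖ ^ (-a) + ‖r‖ ^ (-b)) := by
  obtain ⟨η, hη, hη1, hη2⟩ : ∃ η : ℝ, 0 < η ∧ a + η ≤ z.re ∧ z.re + η ≤ b :=
    ⟨min (z.re - a) (b - z.re), lt_min (by linarith) (by linarith),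
      by linarith [min_le_left (z.re - a) (b - z.re)],
      by linarith [min_le_right (z.re - a) (b - z.re)]⟩
  choose K hK0 hK using fun i : ℕ => exists_add_pow_le_mul_exp i Real.pi Real.pi_pos.le hη
  refine ⟨∑ i ∈ Finset.range (j + 1), (j.choose i : ℝ) *
      (K i * Real.exp (Real.pi * |z.im|)) * ‖iteratedDeriv (j - i) Complex.Gamma z‖,
    Finset.sum_nonneg fun i _ => by have := hK0 i; positivity, fun r hr => ?_⟩
  have hr' : 0 < ‖r‖ := norm_pos_iff.2 hr
  rw [expGammaDeriv_eq hz, Finset.sum_mul]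
  refine (norm_sum_le _ _).trans (Finset.sum_le_sum fun i _ => ?_)
  have harg : |(Complex.log r).im| ≤ Real.pi := by
    rw [Complex.log_im]
    exact Complex.abs_arg_le_pi r
  have h1 : ‖(-Complex.log r) ^ i‖ ≤ K i * Real.exp (η * |Real.log ‖r‖|) := by
    rw [norm_pow, norm_neg]
    refine le_trans ?_ (hK i _ (abs_nonneg _))
    gcongr
    refine (Complex.norm_le_abs_re_add_abs_im _).trans ?_
    rw [Complex.log_re]
    linarith
  have h2 : ‖Complex.exp (-Complex.log r * z)‖ ≤
      Real.exp (-z.re * Real.log ‖r‖) * Real.exp (Real.pi * |z.im|) := by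
    rw [Complex.norm_exp, ← Real.exp_add]
    refine Real.exp_le_exp.2 ?_
    rw [Complex.mul_re, Complex.neg_re, Complex.neg_im, Complex.log_re]
    have h3 : (Complex.log r).im * z.im ≤ Real.pi * |z.im| := by
      refine (le_abs_self _).trans ?_
      rw [abs_mul]
      gcongr
    linarith
  have h3 := exp_mul_log_add_le hη1 hη2 hr'
  rw [norm_mul, norm_mul, norm_mul, Complex.norm_natCast]
  have h4 : ‖(-Complex.log r) ^ i‖ * ‖Complex.exp (-Complex.log r * z)‖ ≤
      K i * Real.exp (Real.pi * |z.im|) * (‖r‖ ^ (-a) + ‖r‖ ^ (-b)) := by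
    calc _ ≤ (K i * Real.exp (η * |Real.log ‖r‖|)) *
          (Real.exp (-z.re * Real.log ‖r‖) * Real.exp (Real.pi * |z.im|)) := by
          gcongr
          have := hK0 i
          positivity
      _ = K i * Real.exp (Real.pi * |z.im|) *
          Real.exp (-z.re * Real.log ‖r‖ + η * |Real.log ‖r‖|) := by
          rw [Real.exp_add]
          ring
      _ ≤ _ := by
          have := hK0 i
          gcongr
  calc _ ≤ (j.choose i : ℝ) * (K i * Real.exp (Real.pi * |z.im|) * (‖r‖ ^ (-a) + ‖r‖ ^ (-b))) *
        ‖iteratedDeriv (j - i) Complex.Gamma z‖ := by gcongr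
    _ = _ := by ring

/-! ### Scalar kernels -/

/-- The function `v ↦ (log v) ^ j * v ^ (z - 1)` on the positive half-line, extended by zero. -/
def logPow (z : ℂ) (j : ℕ) (v : ℝ) : ℂ :=
  if 0 < v then (Real.log v : ℂ) ^ j * (v : ℂ) ^ (z - 1) else 0

/-- The scalar kernel `u ↦ logPow z j (s (t - u)) - logPow z j (s (-u))`. -/
def logKernel (s : ℝ) (z : ℂ) (j : ℕ) (t u : ℝ) : ℂ :=
  logPow z j (s * (t - u)) - logPow z j (s * (-u))

/-- The Fourier transform of `logKernel s z j t`. -/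
def logKernelTransform (s : ℝ) (z : ℂ) (j : ℕ) (t x : ℝ) : ℂ :=
  (Complex.exp (Complex.I * t * x) - 1) * expGammaDeriv z j (Complex.log (Complex.I * (s * x : ℝ)))

theorem logPow_mul_exp_eq_indicator (z r : ℂ) (j : ℕ) :
    (fun v : ℝ => logPow z j v * Complex.exp (-(r * v))) =
      (Ioi 0).indicator fun v : ℝ => (v : ℂ) ^ (z - 1) • logExp r j v := by
  ext v
  by_cases hv : 0 < v
  · rw [indicator_of_mem (mem_Ioi.2 hv), logPow, if_pos hv, logExp, smul_eq_mul]
    ring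
  · rw [indicator_of_notMem (by simpa using hv), logPow, if_neg hv, zero_mul]

theorem integrable_logPow_mul_exp {z r : ℂ} (hz : 0 < z.re) (hr : 0 < r.re) (j : ℕ) :
    Integrable (fun v : ℝ => logPow z j v * Complex.exp (-(r * v))) := by
  rw [logPow_mul_exp_eq_indicator, integrable_indicator_iff measurableSet_Ioi]
  exact (mellin_logExp hr hz j).1

theorem integral_logPow_mul_exp {z r : ℂ} (hz : 0 < z.re) (hr : 0 < r.re) (j : ℕ) :
    ∫ v : ℝ, logPow z j v * Complex.exp (-(r * v)) = expGammaDeriv z j (Complex.log r) := by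
  rw [logPow_mul_exp_eq_indicator, integral_indicator measurableSet_Ioi, ← mellin_logExp_eq hr hz]
  rfl

/-- Squaring gives a function of the same type with parameters 2z - 1, 2r, 2j, integrable because
Re(2z - 1) > 0. -/
theorem memLp_two_logPow_mul_exp {z r : ℂ} (hz : 1 / 2 < z.re) (hr : 0 < r.re) (j : ℕ) :
    MemLp (fun v : ℝ => logPow z j v * Complex.exp (-(r * v))) 2 volume := by
  rw [memLp_two_iff_integrable_sq_norm
    (integrable_logPow_mul_exp (by linarith) hr j).aestronglyMeasurable]
  have h := integrable_logPow_mul_exp (z := 2 * z - 1) (r := 2 * r)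
    (by simp; linarith) (by simpa using hr) (2 * j)
  refine h.norm.congr (Eventually.of_forall fun v => ?_)
  simp only
  rw [← norm_pow]
  congr 1
  rw [mul_pow, ← Complex.exp_nat_mul]
  congr 1
  · rw [logPow, logPow]
    split_ifs with hv
    · have hv0 : (v : ℂ) ≠ 0 := by exact_mod_cast hv.ne'
      rw [mul_pow, ← pow_mul, mul_comm j 2, ← Complex.cpow_nat_mul]
      congr 2
      push_cast
      ring
    · simp
  · push_cast
    ring_nf

theorem measurePreserving_mul_sub {s : ℝ} (hs : s = 1 ∨ s = -1) (t : ℝ) :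
    MeasurePreserving (fun u : ℝ => s * (t - u)) volume volume := by
  rcases hs with rfl | rfl
  · simpa using Measure.measurePreserving_sub_left volume t
  · simpa using measurePreserving_sub_right volume t

theorem integral_comp_mul_sub {s : ℝ} (hs : s = 1 ∨ s = -1) (t : ℝ) (F : ℝ → ℂ) :
    ∫ u : ℝ, F (s * (t - u)) = ∫ v : ℝ, F v := by
  rcases hs with rfl | rfl
  · simpa using integral_sub_left_eq_self F volume t
  · simpa using integral_sub_right_eq_self F (μ := volume) t

/-- Substitute v = s(t - u). As s² = 1, e^(iux) = e^(itx) e^(-isxv), and the oscillation merges with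
the damping into the complex rate ε + isx. -/
theorem integral_exp_mul_comp_mul_sub {s : ℝ} (hs : s = 1 ∨ s = -1) {z : ℂ} (hz : 0 < z.re)
    (j : ℕ) (t x : ℝ) {ε : ℝ} (hε : 0 < ε) :
    ∫ u : ℝ, Complex.exp (Complex.I * u * x) * (logPow z j (s * (t - u)) *
        Complex.exp (-((ε : ℂ) * (s * (t - u) : ℝ)))) =
      Complex.exp (Complex.I * t * x) *
        expGammaDeriv z j (Complex.log (ε + Complex.I * (s * x : ℝ))) := by
  rw [← integral_logPow_mul_exp hz (by simpa using hε), ← integral_const_mul,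
    ← integral_comp_mul_sub hs t (fun v : ℝ => Complex.exp (Complex.I * t * x) * (logPow z j v *
      Complex.exp (-((ε + Complex.I * (s * x : ℝ)) * v))))]
  refine integral_congr_ae (Eventually.of_forall fun u => ?_)
  have hs2 : (s : ℂ) * s = 1 := by
    rcases hs with rfl | rfl <;> simp
  simp only
  rw [mul_left_comm, mul_left_comm (Complex.exp (Complex.I * t * x)), ← Complex.exp_add,
    ← Complex.exp_add]
  congr 2
  push_cast
  linear_combination (Complex.I * x * (t - u)) * hs2

theorem integrable_comp_abs {f : ℝ → ℝ} (hf : IntegrableOn f (Ioi 0)) :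
    Integrable (fun x => f |x|) := by
  have h : IntegrableOn (fun x => f |x|) (Ioi 0) :=
    hf.congr_fun (fun x hx => by rw [abs_of_pos hx]) measurableSet_Ioi
  have h' : IntegrableOn (fun x => f |x|) (Iic 0) := by
    rw [← Measure.map_neg_eq_self (volume : Measure ℝ)]
    let m : MeasurableEmbedding fun x : ℝ => -x := (Homeomorph.neg ℝ).measurableEmbedding
    rw [m.integrableOn_map_iff]
    simp_rw [Function.comp_def, abs_neg, neg_preimage, neg_Iic, neg_zero]
    exact (integrableOn_Ici_iff_integrableOn_Ioi (by simp)).2 h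
  rw [← integrableOn_univ, ← Iic_union_Ioi (a := (0 : ℝ))]
  exact h'.union h

/-- For |x| ≤ 1 use |e^(itx) - 1| ≤ |tx|, so that 2 - 2a > -1 suffices; for |x| > 1 use the bound 2,
so that 2a > 1 suffices. -/
theorem memLp_two_exp_sub_one_mul_rpow (t : ℝ) {a : ℝ} (ha : 1 / 2 < a) (ha' : a < 3 / 2) :
    MemLp (fun x : ℝ => ‖Complex.exp (Complex.I * t * x) - 1‖ * |x| ^ (-a)) 2 volume := by
  have hmeas : Measurable (fun x : ℝ => ‖Complex.exp (Complex.I * t * x) - 1‖ * |x| ^ (-a)) := by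
    fun_prop
  rw [memLp_two_iff_integrable_sq hmeas.aestronglyMeasurable]
  have hf : IntegrableOn (fun y : ℝ => if y ≤ 1 then t ^ 2 * y ^ (2 - 2 * a)
      else 4 * y ^ (-(2 * a))) (Ioi 0) := by
    rw [← Ioc_union_Ioi_eq_Ioi zero_le_one, integrableOn_union]
    constructor
    · have h : IntegrableOn (fun y : ℝ => y ^ (2 - 2 * a)) (Ioc 0 1) := by
        rw [← intervalIntegrable_iff_integrableOn_Ioc_of_le zero_le_one]
        exact intervalIntegral.intervalIntegrable_rpow' (by linarith)
      refine IntegrableOn.congr_fun (h.const_mul (t ^ 2)) (fun y hy => ?_) measurableSet_Ioc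
      rw [if_pos hy.2]
    · refine IntegrableOn.congr_fun
        ((integrableOn_Ioi_rpow_of_lt (a := -(2 * a)) (by linarith) zero_lt_one).const_mul 4)
        (fun y hy => ?_) measurableSet_Ioi
      rw [if_neg (not_le.2 hy)]
  refine (integrable_comp_abs hf).mono' (by fun_prop) ?_
  have hne : ∀ᵐ ξ : ℝ, ξ ≠ 0 := by simp [ae_iff]
  filter_upwards [hne] with x hx
  have hx' : 0 < |x| := abs_pos.2 hx
  rw [Real.norm_of_nonneg (by positivity), mul_pow]
  have h1 : (|x| ^ (-a)) ^ 2 = |x| ^ (-(2 * a)) := by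
    rw [← Real.rpow_natCast, ← Real.rpow_mul hx'.le]
    congr 1
    push_cast
    ring
  rw [h1]
  have harg : Complex.I * t * x = Complex.I * (t * x : ℝ) := by push_cast; ring
  split_ifs with h
  · have h2 : |x| ^ (2 - 2 * a) = |x| ^ 2 * |x| ^ (-(2 * a)) := by
      rw [sub_eq_add_neg, Real.rpow_add hx']
      norm_num
    rw [h2, ← mul_assoc]
    gcongr
    rw [← sq_abs t, ← mul_pow, harg]
    gcongr
    simpa [abs_mul] using Real.norm_exp_I_mul_ofReal_sub_one_le (x := t * x)
  · gcongr
    have h3 : ‖Complex.exp (Complex.I * t * x) - 1‖ ≤ 2 := by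
      refine (norm_sub_le _ _).trans ?_
      rw [harg, Complex.norm_exp_I_mul_ofReal, norm_one]
      norm_num
    calc _ ≤ (2 : ℝ) ^ 2 := by gcongr
      _ = 4 := by norm_num

theorem I_mul_mem_slitPlane {s x : ℝ} (hs : s = 1 ∨ s = -1) (hx : x ≠ 0) :
    Complex.I * (s * x : ℝ) ∈ Complex.slitPlane := by
  refine Or.inr ?_
  have : s ≠ 0 := by rcases hs with rfl | rfl <;> norm_num
  simp [this, hx]

theorem hasFourierL2_logKernel {s : ℝ} (hs : s = 1 ∨ s = -1) {z : ℂ} (hz : 1 / 2 < z.re)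
    (hz' : z.re < 3 / 2) (j : ℕ) (t : ℝ) :
    HasFourierL2 (logKernel s z j t) (logKernelTransform s z j t) := by
  have hz0 : 0 < z.re := by linarith
  -- The open range of Re z leaves room for exponents a < Re z < b that still give square integrable
  -- majorants.
  obtain ⟨a, ha, ha'⟩ := exists_between hz
  obtain ⟨b, hb, hb'⟩ := exists_between hz'
  obtain ⟨C, hC0, hC⟩ := exists_norm_expGammaDeriv_log_le hz0 j ha' hb
  let ε : ℕ → ℝ := fun N => 1 / ((N : ℝ) + 1)
  have hε : ∀ N, 0 < ε N := fun N => Nat.one_div_pos_of_nat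
  have hεlim : Tendsto ε atTop (𝓝 0) := tendsto_one_div_add_atTop_nhds_zero_nat
  let f : ℕ → ℝ → ℂ := fun N v => logPow z j v * Complex.exp (-((ε N : ℂ) * v))
  have hf1 : ∀ N, Integrable (f N) := fun N =>
    integrable_logPow_mul_exp hz0 (by simpa using hε N) j
  have hf2 : ∀ N, MemLp (f N) 2 volume := fun N =>
    memLp_two_logPow_mul_exp hz (by simpa using hε N) j
  have hi : ∀ N t, Integrable (fun u => f N (s * (t - u))) := fun N t =>
    (measurePreserving_mul_sub hs t).integrable_comp_of_integrable (hf1 N)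
  have hr : ∀ N x, ((ε N : ℂ) + Complex.I * (s * x : ℝ)).re = ε N := fun N x => by simp
  -- The imaginary part alone bounds the modulus from below, so negative powers of it are bounded
  -- uniformly in ε.
  have habs : ∀ N x, |x| ≤ ‖(ε N : ℂ) + Complex.I * (s * x : ℝ)‖ := fun N x => by
    refine le_trans (le_of_eq ?_) (Complex.abs_im_le_norm _)
    rcases hs with rfl | rfl <;> simp
  refine hasFourierL2_of_tendsto
    (g := fun N u => f N (s * (t - u)) - f N (s * (0 - u)))
    (m := fun N x => (Complex.exp (Complex.I * t * x) - 1) *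
      expGammaDeriv z j (Complex.log (ε N + Complex.I * (s * x : ℝ))))
    (B := fun x => C * (‖Complex.exp (Complex.I * t * x) - 1‖ * |x| ^ (-a) +
      ‖Complex.exp (Complex.I * t * x) - 1‖ * |x| ^ (-b)))
    (fun N => (hi N t).sub (hi N 0))
    (fun N => ((hf2 N).comp_measurePreserving (measurePreserving_mul_sub hs t)).sub
      ((hf2 N).comp_measurePreserving (measurePreserving_mul_sub hs 0)))
    (fun N x => ?_)
    (((memLp_two_exp_sub_one_mul_rpow t ha (by linarith)).add
      (memLp_two_exp_sub_one_mul_rpow t (by linarith) hb')).const_mul C)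
    (fun N x hx => ?_) (fun x hx => ?_) (Eventually.of_forall fun u => ?_)
  · have hexp : ∀ t, Integrable (fun u : ℝ =>
        Complex.exp (Complex.I * u * x) * f N (s * (t - u))) := fun t => by
      refine (hi N t).bdd_mul (c := 1) (by fun_prop) (Eventually.of_forall fun u => ?_)
      have : Complex.I * u * x = Complex.I * (u * x : ℝ) := by push_cast; ring
      rw [this, Complex.norm_exp_I_mul_ofReal]
    have hsub := integral_sub (hexp t) (hexp 0)
    simp only [← mul_sub] at hsub
    rw [hsub]
    simp only [f]
    rw [integral_exp_mul_comp_mul_sub hs hz0 j t x (hε N),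
      integral_exp_mul_comp_mul_sub hs hz0 j 0 x (hε N)]
    simp
    ring
  · have hx' : 0 < |x| := abs_pos.2 hx
    have hne : (ε N : ℂ) + Complex.I * (s * x : ℝ) ≠ 0 := fun h => by
      have := hr N x
      rw [h] at this
      simp at this
      exact (hε N).ne this
    have h1 := hC _ hne
    have h2 : ∀ c : ℝ, 0 < c →
        ‖(ε N : ℂ) + Complex.I * (s * x : ℝ)‖ ^ (-c) ≤ |x| ^ (-c) := fun c hc =>
      Real.rpow_le_rpow_of_nonpos hx' (habs N x) (by linarith)
    rw [norm_mul]
    calc _ ≤ ‖Complex.exp (Complex.I * t * x) - 1‖ * (C * (|x| ^ (-a) + |x| ^ (-b))) := by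
          gcongr
          refine h1.trans ?_
          gcongr C * (?_ + ?_)
          · exact h2 a (by linarith)
          · exact h2 b (by linarith)
      _ = _ := by ring
  · refine Tendsto.const_mul _ (((continuous_expGammaDeriv hz0 j).tendsto _).comp ?_)
    refine (continuousAt_clog (I_mul_mem_slitPlane hs hx)).tendsto.comp ?_
    have h1 : Tendsto (fun N => (ε N : ℂ)) atTop (𝓝 0) := by
      exact_mod_cast (Complex.continuous_ofReal.tendsto 0).comp hεlim
    simpa using h1.add_const (Complex.I * (s * x : ℝ))
  · have h1 : ∀ v : ℝ, Tendsto (fun N => f N v) atTop (𝓝 (logPow z j v)) := fun v => by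
      have h2 : Tendsto (fun N => (ε N : ℂ)) atTop (𝓝 0) := by
        exact_mod_cast (Complex.continuous_ofReal.tendsto 0).comp hεlim
      have h3 := ((h2.mul_const (v : ℂ)).neg.cexp).const_mul (logPow z j v)
      simpa using h3
    have := (h1 (s * (t - u))).sub (h1 (s * (0 - u)))
    simpa [logKernel] using this

/-! ### Integrability of the scalar kernels -/

/-- The damping is undone by the factor e^v, bounded by e^R on the half-line. -/
theorem integrableOn_Iic_logPow {z : ℂ} (hz : 0 < z.re) (j : ℕ) (R : ℝ) :
    IntegrableOn (logPow z j) (Iic R) := by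
  have h := (integrable_logPow_mul_exp hz (r := 1) (by simp) j).integrableOn (s := Iic R)
  have h2 : IntegrableOn (fun v : ℝ => Complex.exp v *
      (logPow z j v * Complex.exp (-(1 * (v : ℂ))))) (Iic R) := by
    refine h.bdd_mul (c := Real.exp R) (by fun_prop) ?_
    filter_upwards [ae_restrict_mem measurableSet_Iic] with v hv
    rw [Complex.norm_exp, Complex.ofReal_re]
    exact Real.exp_le_exp.2 hv
  refine h2.congr_fun (fun v _ => ?_) measurableSet_Iic
  simp only
  rw [one_mul, mul_left_comm, ← Complex.exp_add]
  simp

/-- The derivative combines (log y)^i y^(z-2) for i = j - 1 and i = j, and η absorbs the logarithms.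
For j = 0 the truncated j - 1 is harmless, its term having coefficient j. -/
theorem exists_hasDerivAt_logPow {z : ℂ} (j : ℕ) {η : ℝ} (hη : 0 < η) :
    ∃ (K : ℝ) (ψ : ℝ → ℂ), 0 ≤ K ∧ ∀ y : ℝ, 0 < y → HasDerivAt (logPow z j) (ψ y) y ∧
      ‖ψ y‖ ≤ K * (y ^ (-(2 - z.re - η)) + y ^ (-(2 - z.re + η))) := by
  choose K hK0 hK using fun i : ℕ => exists_add_pow_le_mul_exp i 0 le_rfl hη
  have hbound : ∀ (i : ℕ) (y : ℝ), 0 < y → ‖(Real.log y : ℂ) ^ i * (y : ℂ) ^ (z - 2)‖ ≤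
      K i * (y ^ (-(2 - z.re - η)) + y ^ (-(2 - z.re + η))) := fun i y hy => by
    rw [norm_mul, norm_pow, Complex.norm_real, Complex.norm_cpow_eq_rpow_re_of_pos hy,
      Real.norm_eq_abs]
    have h1 := hK i |Real.log y| (abs_nonneg _)
    rw [add_zero] at h1
    have h2 := exp_mul_log_add_le (a := 2 - z.re - η) (b := 2 - z.re + η) (c := 2 - z.re)
      (η := η) (by linarith) le_rfl hy
    have h3 : y ^ (z - 2).re = Real.exp (-(2 - z.re) * Real.log y) := by
      rw [Real.rpow_def_of_pos hy]
      congr 1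
      simp
      ring
    calc _ ≤ (K i * Real.exp (η * |Real.log y|)) * y ^ (z - 2).re := by gcongr
      _ = K i * Real.exp (-(2 - z.re) * Real.log y + η * |Real.log y|) := by
        rw [h3, Real.exp_add]
        ring
      _ ≤ _ := by
        have := hK0 i
        gcongr
  refine ⟨j * K (j - 1) + K j * ‖z - 1‖, fun y =>
    j * ((Real.log y : ℂ) ^ (j - 1) * (y : ℂ) ^ (z - 2)) +
      (Real.log y : ℂ) ^ j * (y : ℂ) ^ (z - 2) * (z - 1),
    by have := hK0 j; have := hK0 (j - 1); positivity, fun y hy => ⟨?_, ?_⟩⟩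
  · have hy0 : (y : ℂ) ≠ 0 := by exact_mod_cast hy.ne'
    have h1 : HasDerivAt (fun y : ℝ => (Real.log y : ℂ)) ((y⁻¹ : ℝ) : ℂ) y :=
      (Real.hasDerivAt_log hy.ne').ofReal_comp
    have h2 : HasDerivAt (fun y : ℝ => (y : ℂ) ^ (z - 1)) ((z - 1) * (y : ℂ) ^ (z - 1 - 1)) y :=
      ((hasDerivAt_id (y : ℂ)).cpow_const (Or.inl (by simpa using hy))).comp_ofReal.congr_deriv
        (by simp)
    have h3 := (h1.pow j).mul h2
    have h4 : HasDerivAt (fun y : ℝ => (Real.log y : ℂ) ^ j * (y : ℂ) ^ (z - 1))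
        (j * ((Real.log y : ℂ) ^ (j - 1) * (y : ℂ) ^ (z - 2)) +
          (Real.log y : ℂ) ^ j * (y : ℂ) ^ (z - 2) * (z - 1)) y := by
      refine h3.congr_deriv ?_
      have h5 : (y : ℂ) ^ (z - 1) = (y : ℂ) ^ (z - 2) * y := by
        rw [show z - 1 = z - 2 + 1 by ring, Complex.cpow_add _ _ hy0, Complex.cpow_one]
      rw [h5, show z - 1 - 1 = z - 2 by ring]
      push_cast
      simp only [Pi.pow_apply]
      field_simp
    refine h4.congr_of_eventuallyEq ?_
    filter_upwards [lt_mem_nhds hy] with w hw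
    rw [logPow, if_pos hw]
  · refine (norm_add_le _ _).trans ?_
    rw [norm_mul, norm_mul _ (z - 1), Complex.norm_natCast]
    calc _ ≤ (j : ℝ) * (K (j - 1) * (y ^ (-(2 - z.re - η)) + y ^ (-(2 - z.re + η)))) +
          K j * (y ^ (-(2 - z.re - η)) + y ^ (-(2 - z.re + η))) * ‖z - 1‖ := by
          gcongr
          · exact hbound _ y hy
          · exact hbound _ y hy
      _ = _ := by ring

/-- Up to 2|τ| + 1 each term is integrable. Beyond, w and w + τ both exceed w/2, and the mean value
inequality bounds the difference by |τ| times powers of w/2 with exponents -(2 - Re z ∓ η), below -1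
because η < 1 - Re z. -/
theorem integrable_logPow_add_sub {z : ℂ} (hz : 0 < z.re) (hz' : z.re < 1) (j : ℕ) (τ : ℝ) :
    Integrable (fun w => logPow z j (w + τ) - logPow z j w) := by
  obtain ⟨η, hη, hη'⟩ : ∃ η : ℝ, 0 < η ∧ η < 1 - z.re := exists_between (by linarith)
  obtain ⟨K, ψ, hK, hψ⟩ := exists_hasDerivAt_logPow (z := z) j hη
  have hR : 0 < 2 * |τ| + 1 := by positivity
  have hshift : IntegrableOn (fun w => logPow z j (w + τ)) (Iic (2 * |τ| + 1)) := by
    have h := ((integrable_indicator_iff measurableSet_Iic).2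
      (integrableOn_Iic_logPow hz j (2 * |τ| + 1 + τ))).comp_add_right τ
    rw [← integrable_indicator_iff measurableSet_Iic]
    refine h.congr (Eventually.of_forall fun w => ?_)
    simp [indicator]
  rw [← integrableOn_univ, ← Iic_union_Ioi (a := 2 * |τ| + 1), integrableOn_union]
  refine ⟨hshift.sub (integrableOn_Iic_logPow hz j _), ?_⟩
  have hpow : ∀ c : ℝ, 1 < c → IntegrableOn (fun w : ℝ => (w / 2) ^ (-c)) (Ioi (2 * |τ| + 1)) :=
    fun c hc => by
      refine IntegrableOn.congr_fun ((integrableOn_Ioi_rpow_of_lt (a := -c)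
        (by linarith) hR).div_const (2 ^ (-c))) (fun w hw => ?_) measurableSet_Ioi
      rw [Real.div_rpow (hR.trans hw).le (by norm_num)]
  have hint := (((hpow (2 - z.re - η) (by linarith)).add
    (hpow (2 - z.re + η) (by linarith))).const_mul K).mul_const |τ|
  have hcont : ContinuousOn (logPow z j) (Ioi 0) := fun y hy =>
    (hψ y hy).1.continuousAt.continuousWithinAt
  have hpos : ∀ w ∈ Ioi (2 * |τ| + 1), 0 < w / 2 ∧ w / 2 ≤ w ∧ w / 2 ≤ w + τ := fun w hw => by
    have h1 : 2 * |τ| + 1 < w := hw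
    have h2 := neg_abs_le τ
    have h3 := abs_nonneg τ
    refine ⟨by linarith, by linarith, by linarith⟩
  refine Integrable.mono' hint (ContinuousOn.aestronglyMeasurable ?_ measurableSet_Ioi) ?_
  · refine ContinuousOn.sub (hcont.comp (by fun_prop) fun w hw => ?_) (hcont.mono fun w hw => ?_)
    · have := hpos w hw
      exact mem_Ioi.2 (by linarith)
    · have := hpos w hw
      exact mem_Ioi.2 (by linarith)
  · filter_upwards [ae_restrict_mem measurableSet_Ioi] with w hw
    obtain ⟨h1, h2, h3⟩ := hpos w hw
    have h := Convex.norm_image_sub_le_of_norm_hasDerivWithin_le (f := logPow z j) (f' := ψ)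
      (s := Ici (w / 2)) (x := w) (y := w + τ)
      (C := K * ((w / 2) ^ (-(2 - z.re - η)) + (w / 2) ^ (-(2 - z.re + η))))
      (fun y hy => (hψ y (h1.trans_le hy)).1.hasDerivWithinAt) (fun y hy => ?_)
      (convex_Ici _) h2 h3
    · simpa using h
    · refine (hψ y (h1.trans_le hy)).2.trans ?_
      gcongr K * (?_ + ?_)
      · exact Real.rpow_le_rpow_of_nonpos h1 hy (by linarith)
      · exact Real.rpow_le_rpow_of_nonpos h1 hy (by linarith)

theorem integrable_logKernel {s : ℝ} (hs : s = 1 ∨ s = -1) {z : ℂ} (hz : 0 < z.re)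
    (hz' : z.re < 1) (j : ℕ) (t : ℝ) : Integrable (logKernel s z j t) := by
  have h := (measurePreserving_mul_sub hs 0).integrable_comp_of_integrable
    (integrable_logPow_add_sub hz hz' j (s * t))
  refine h.congr (Eventually.of_forall fun u => ?_)
  simp only [Function.comp_def, logKernel]
  ring_nf

/-- The Fourier integral of an integrable function is continuous, and the formula is continuous off
0, where isx avoids the branch cut; almost everywhere equality on an open set is then equality. -/
theorem integral_logKernel {s : ℝ} (hs : s = 1 ∨ s = -1) {z : ℂ} (hz : 1 / 2 < z.re)
    (hz' : z.re < 1) (j : ℕ) (t : ℝ) {x : ℝ} (hx : x ≠ 0) :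
    ∫ u : ℝ, Complex.exp (Complex.I * u * x) * logKernel s z j t u =
      logKernelTransform s z j t x := by
  have hint := integrable_logKernel hs (by linarith) hz' j t
  have hae := (hasFourierL2_logKernel hs hz (by linarith) j t).ae_eq_integral hint
  have hcF : Continuous (𝓕 (logKernel s z j t)) :=
    VectorFourier.fourierIntegral_continuous Real.continuous_fourierChar (by fun_prop) hint
  have hc1 : Continuous fun x : ℝ =>
      ∫ u : ℝ, Complex.exp (Complex.I * u * x) * logKernel s z j t u := by
    simp only [← fourier_neg_div_two_pi]
    exact hcF.comp (by fun_prop)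
  have hc2 : ContinuousOn (logKernelTransform s z j t) {0}ᶜ := by
    refine ContinuousOn.mul (by fun_prop)
      ((continuous_expGammaDeriv (by linarith) j).comp_continuousOn ?_)
    exact ContinuousOn.clog (by fun_prop) fun x hx => I_mul_mem_slitPlane hs hx
  exact Measure.eqOn_open_of_ae_eq (μ := volume) (ae_restrict_of_ae hae) isOpen_compl_singleton
    hc1.continuousOn hc2 hx

/-! ### Matrix kernels -/

/-- Passes from `D` to `D + 1`, so that powers, exponentials and Γ are all evaluated at one matrix.
-/
theorem exp_smul_eq_exp_smul_add_one {n : ℕ} (D : Matrix (Fin n) (Fin n) ℂ) (w : ℂ) :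
    NormedSpace.exp (w • D) = Complex.exp (-w) • NormedSpace.exp (w • (D + 1)) := by
  have h1 : w • D = -w • (1 : Matrix (Fin n) (Fin n) ℂ) + w • (D + 1) := by
    rw [smul_add, neg_smul]
    abel
  have h2 : NormedSpace.exp (-w • (1 : Matrix (Fin n) (Fin n) ℂ)) =
      Complex.exp (-w) • (1 : Matrix (Fin n) (Fin n) ℂ) := by
    have h3 : ∀ c : ℂ, c • (1 : Matrix (Fin n) (Fin n) ℂ) = Matrix.diagonal fun _ => c :=
      fun c => by rw [Matrix.smul_one_eq_diagonal]
    rw [h3, h3, Matrix.exp_diagonal, Pi.exp_def, Complex.exp_eq_exp_ℂ]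
  rw [h1, Matrix.exp_add_of_commute _ _ ((Commute.one_left _).smul_left _), h2, smul_mul_assoc,
    one_mul]

/-- For v > 0, v^D = v⁻¹ v^(D+1), and the j-th derivative of v^z in z is (log v)^j v^z; the factor
v⁻¹ lowers the exponent to z - 1. For v ≤ 0 both sides vanish by convention. -/
theorem realPow_signedPart_apply {n : ℕ} {D : Matrix (Fin n) (Fin n) ℂ} {a b : Fin n}
    {c : (Σ _ : ℂ, ℕ) → ℂ} (hc : ∀ f : ℂ → ℂ, primaryMatrixFun f (D + 1) a b =
      ∑ i ∈ spectralIndex (D + 1), c i * iteratedDeriv i.2 f i.1) (s y : ℝ) :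
    realPow (signedPart s y) D a b =
      ∑ i ∈ spectralIndex (D + 1), c i * logPow i.1 i.2 (s * y) := by
  rw [signedPart]
  rcases le_or_gt (s * y) 0 with h | h
  · rw [max_eq_right h, realPow, if_pos rfl]
    simp [logPow, not_lt.2 h]
  · rw [max_eq_left h.le, realPow, if_neg h.ne', exp_smul_eq_exp_smul_add_one,
      exp_smul_eq_primaryMatrixFun, Matrix.smul_apply, hc, smul_eq_mul, Finset.mul_sum]
    refine Finset.sum_congr rfl fun i _ => ?_
    have h0 : ((s * y : ℝ) : ℂ) ≠ 0 := by exact_mod_cast h.ne'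
    rw [logPow, if_pos h, iteratedDeriv_exp_mul, Complex.cpow_def_of_ne_zero h0,
      ← Complex.ofReal_log h.le, mul_sub, mul_one, sub_eq_neg_add, Complex.exp_add]
    ring

theorem kernel_apply {n : ℕ} {D : Matrix (Fin n) (Fin n) ℂ} {a b : Fin n}
    {c : (Σ _ : ℂ, ℕ) → ℂ} (hc : ∀ f : ℂ → ℂ, primaryMatrixFun f (D + 1) a b =
      ∑ i ∈ spectralIndex (D + 1), c i * iteratedDeriv i.2 f i.1) (s t u : ℝ) :
    kernel s D t u a b = ∑ i ∈ spectralIndex (D + 1), c i * logKernel s i.1 i.2 t u := by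
  rw [kernel, Matrix.sub_apply, realPow_signedPart_apply hc, realPow_signedPart_apply hc,
    ← Finset.sum_sub_distrib]
  simp only [logKernel, mul_sub]

/-- The argument is ±π/2 according to the sign of sx; this is the source of the factor e^(∓ sign(x)
iπD/2). -/
theorem log_I_mul {s x : ℝ} (hs : s = 1 ∨ s = -1) (hx : x ≠ 0) :
    Complex.log (Complex.I * (s * x : ℝ)) =
      Real.log |x| + (s * Real.sign x : ℝ) * Complex.I * Real.pi / 2 := by
  have key : ∀ y : ℝ, y ≠ 0 → Complex.log (Complex.I * y) =
      Real.log |y| + (Real.sign y : ℝ) * Complex.I * Real.pi / 2 := fun y hy => by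
    rcases hy.lt_or_gt with h | h
    · have h1 : Complex.I * (y : ℂ) = ((-y : ℝ) : ℂ) * (-Complex.I) := by push_cast; ring
      rw [h1, Complex.log_ofReal_mul (neg_pos.2 h) (by simp), Complex.log_neg_I,
        Real.sign_of_neg h, abs_of_neg h]
      push_cast
      ring
    · rw [mul_comm, Complex.log_ofReal_mul h Complex.I_ne_zero, Complex.log_I,
        Real.sign_of_pos h, abs_of_pos h]
      push_cast
      ring
  rcases hs with rfl | rfl
  · simpa using key x hx
  · have h := key (-x) (neg_ne_zero.2 hx)
    rw [Real.sign_neg, abs_neg] at h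
    rw [neg_one_mul, neg_one_mul]
    exact h

/-- With l = log(isx), the three matrix factors multiply to e^l times the primary function of
e^(-lz) Γ(z) at `D + 1`. The factor e^l = isx, left over from the shift to `D + 1`, cancels s/(ix).
-/
theorem kernelTransform_apply {n : ℕ} {D : Matrix (Fin n) (Fin n) ℂ} {a b : Fin n}
    {c : (Σ _ : ℂ, ℕ) → ℂ} (hc : ∀ f : ℂ → ℂ, primaryMatrixFun f (D + 1) a b =
      ∑ i ∈ spectralIndex (D + 1), c i * iteratedDeriv i.2 f i.1)
    (hD : ∀ z ∈ (minpoly ℂ (D + 1)).roots, 0 < z.re) {s : ℝ} (hs : s = 1 ∨ s = -1) (t : ℝ)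
    {x : ℝ} (hx : x ≠ 0) :
    kernelTransform s D t x a b =
      ∑ i ∈ spectralIndex (D + 1), c i * logKernelTransform s i.1 i.2 t x := by
  set l := Complex.log (Complex.I * (s * x : ℝ)) with hl
  have hl2 := log_I_mul hs hx
  rw [← hl] at hl2
  set r : ℂ := (Real.log |x| : ℂ) with hr
  set θ : ℂ := -(s * Real.sign x : ℝ) * Complex.I * Real.pi / 2 with hθ
  have hlr : l = r - θ := by
    rw [hl2, hθ]
    ring
  have hexpl : Complex.exp l = Complex.I * (s * x : ℝ) :=
    Complex.exp_log (Complex.slitPlane_ne_zero (I_mul_mem_slitPlane hs hx))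
  have hexp : ∀ w z : ℂ, AnalyticAt ℂ (fun z => Complex.exp (w * z)) z := fun w z => by fun_prop
  have hprod : realPow |x| (-D) * primaryMatrixFun Complex.Gamma (D + 1) *
      NormedSpace.exp (θ • D) = Complex.exp l •
        primaryMatrixFun (fun z => Complex.exp (-l * z) * Complex.Gamma z) (D + 1) := by
    have h1 : (fun z : ℂ => Complex.exp (-l * z) * Complex.Gamma z) =
        fun z => (Complex.exp (-r * z) * Complex.Gamma z) * Complex.exp (θ * z) := by
      ext z
      rw [mul_right_comm, ← Complex.exp_add, hlr]
      ring_nf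
    rw [h1, primaryMatrixFun_mul (D + 1) (f := fun z => Complex.exp (-r * z) * Complex.Gamma z)
      (fun z hz => (hexp _ z).mul (analyticAt_Gamma (hD z hz))) (fun z _ => hexp _ z),
      primaryMatrixFun_mul (D + 1) (fun z _ => hexp _ z) (fun z hz => analyticAt_Gamma (hD z hz)),
      realPow, if_neg (abs_ne_zero.2 hx), smul_neg, ← neg_smul, ← hr,
      exp_smul_eq_exp_smul_add_one, exp_smul_eq_exp_smul_add_one D θ,
      exp_smul_eq_primaryMatrixFun, exp_smul_eq_primaryMatrixFun, smul_mul_assoc, smul_mul_assoc,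
      mul_smul_comm, smul_smul, ← Complex.exp_add, hlr]
    congr 2
    ring
  have hs2 : (s : ℂ) * s = 1 := by
    rcases hs with rfl | rfl <;> simp
  have hx0 : (x : ℂ) ≠ 0 := by exact_mod_cast hx
  have hscal : (s : ℂ) * ((Complex.exp (Complex.I * t * x) - 1) / (Complex.I * x)) *
      Complex.exp l = Complex.exp (Complex.I * t * x) - 1 := by
    rw [hexpl]
    push_cast
    field_simp
    linear_combination (Complex.exp (Complex.I * t * x) - 1) * hs2
  rw [kernelTransform, hprod, smul_smul, hscal, Matrix.smul_apply, hc, smul_eq_mul, Finset.mul_sum]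
  refine Finset.sum_congr rfl fun i _ => ?_
  rw [logKernelTransform, expGammaDeriv, ← hl]
  ring

/-- The minimal polynomial divides the characteristic polynomial, and adding a scalar matrix
translates the roots of the latter. -/
theorem isRoot_charpoly_of_mem_roots_minpoly {n : ℕ} {A : Matrix (Fin n) (Fin n) ℂ} {c z : ℂ}
    (hz : z ∈ (minpoly ℂ (A + c • 1)).roots) : A.charpoly.IsRoot (z - c) := by
  have h1 : (A + c • 1).charpoly.IsRoot z :=
    (isRoot_of_mem_roots hz).dvd (Matrix.minpoly_dvd_charpoly _)
  rw [IsRoot.def, Matrix.eval_charpoly] at h1 ⊢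
  rw [← h1]
  congr 1
  simp only [map_sub, ← Matrix.smul_one_eq_diagonal, Matrix.scalar_apply]
  abel

theorem fst_mem_roots_of_mem_spectralIndex {n : ℕ} {Λ : Matrix (Fin n) (Fin n) ℂ}
    {i : Σ _ : ℂ, ℕ} (hi : i ∈ spectralIndex Λ) : i.1 ∈ (minpoly ℂ Λ).roots :=
  Multiset.mem_toFinset.1 (Finset.mem_sigma.1 hi).1

theorem hasFourierL2_kernel {n : ℕ} {D : Matrix (Fin n) (Fin n) ℂ}
    (hD : ∀ z ∈ (minpoly ℂ (D + 1)).roots, 1 / 2 < z.re ∧ z.re < 3 / 2) {s : ℝ}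
    (hs : s = 1 ∨ s = -1) (t : ℝ) (a b : Fin n) :
    HasFourierL2 (fun u => kernel s D t u a b) (fun x => kernelTransform s D t x a b) := by
  obtain ⟨c, hc⟩ := exists_primaryMatrixFun_apply_eq_sum (D + 1) a b
  have h : HasFourierL2 (fun u => kernel s D t u a b)
      (fun x => ∑ i ∈ spectralIndex (D + 1), c i * logKernelTransform s i.1 i.2 t x) := by
    simp only [kernel_apply hc]
    refine HasFourierL2.sum _ fun i hi => HasFourierL2.const_mul ?_ _
    have := hD i.1 (fst_mem_roots_of_mem_spectralIndex hi)
    exact hasFourierL2_logKernel hs this.1 this.2 i.2 t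
  obtain ⟨hL, h⟩ := h
  have hne : ∀ᵐ x : ℝ, x ≠ 0 := by simp [ae_iff]
  refine ⟨hL, ?_⟩
  filter_upwards [h, hne] with x h1 h2
  rw [h1, kernelTransform_apply hc (fun z hz => by linarith [(hD z hz).1]) hs t h2]

theorem integrable_kernel_and_integral_eq {n : ℕ} {D : Matrix (Fin n) (Fin n) ℂ}
    (hD : ∀ z ∈ (minpoly ℂ (D + 1)).roots, 1 / 2 < z.re ∧ z.re < 1) {s : ℝ}
    (hs : s = 1 ∨ s = -1) (t : ℝ) (a b : Fin n) :
    Integrable (fun u => kernel s D t u a b) ∧ ∀ x : ℝ, x ≠ 0 →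
      ∫ u : ℝ, Complex.exp (Complex.I * u * x) * kernel s D t u a b =
        kernelTransform s D t x a b := by
  obtain ⟨c, hc⟩ := exists_primaryMatrixFun_apply_eq_sum (D + 1) a b
  have hint : ∀ i ∈ spectralIndex (D + 1), Integrable (logKernel s i.1 i.2 t) := fun i hi => by
    have := hD i.1 (fst_mem_roots_of_mem_spectralIndex hi)
    exact integrable_logKernel hs (by linarith) this.2 i.2 t
  simp only [kernel_apply hc]
  refine ⟨integrable_finsetSum _ fun i hi => (hint i hi).const_mul _, fun x hx => ?_⟩
  rw [kernelTransform_apply hc (fun z hz => by linarith [(hD z hz).1]) hs t hx]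
  simp only [Finset.mul_sum, mul_left_comm (Complex.exp _)]
  rw [integral_finsetSum]
  · refine Finset.sum_congr rfl fun i hi => ?_
    have := hD i.1 (fst_mem_roots_of_mem_spectralIndex hi)
    rw [integral_const_mul, integral_logKernel hs this.1 this.2 i.2 t hx]
  · refine fun i hi => Integrable.const_mul ?_ _
    refine (hint i hi).bdd_mul (c := 1) (by fun_prop) (Eventually.of_forall fun u => ?_)
    have : Complex.I * u * x = Complex.I * (u * x : ℝ) := by push_cast; ring
    rw [this, Complex.norm_exp_I_mul_ofReal]

end OFBM
end

/-- The matrix kernels of operator fractional Brownian motion lie in `L²(ℝ)` entrywise, and their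
entrywise Fourier transform (in the sense of `L²`, and given by an absolutely convergent integral
when `D` has characteristic roots with negative real parts) is `OFBM.kernelTransform`. -/
theorem proposition3p1 (n : ℕ) (H : Matrix (Fin n) (Fin n) ℝ)
    (hH : ∀ h : ℂ, (H.map (algebraMap ℝ ℂ)).charpoly.IsRoot h →
      0 < h.re ∧ h.re < 1 ∧ h.re ≠ 1 / 2)
    (D : Matrix (Fin n) (Fin n) ℂ)
    (hD : D = (H - (1 / 2 : ℝ) • (1 : Matrix (Fin n) (Fin n) ℝ)).map (algebraMap ℝ ℂ))
    (s : ℝ) (hs : s = 1 ∨ s = -1) (t : ℝ) :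
    (∀ i j : Fin n, ∃ hL : MemLp (fun u : ℝ => OFBM.kernel s D t u i j) 2 volume,
      ∀ᵐ x : ℝ, OFBM.fourierL2 (fun u : ℝ => OFBM.kernel s D t u i j) hL x
        = OFBM.kernelTransform s D t x i j) ∧
    ((∀ h : ℂ, (H.map (algebraMap ℝ ℂ)).charpoly.IsRoot h → h.re < 1 / 2) →
      ∀ i j : Fin n, Integrable (fun u : ℝ => OFBM.kernel s D t u i j) volume ∧
        ∀ x : ℝ, x ≠ 0 →
          ∫ u : ℝ, Complex.exp (Complex.I * u * x) * OFBM.kernel s D t u i j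
            = OFBM.kernelTransform s D t x i j) := by
  have hroot : ∀ z ∈ (minpoly ℂ (D + 1)).roots,
      (H.map (algebraMap ℝ ℂ)).charpoly.IsRoot (z - 1 / 2) := fun z hz => by
    -- Roots z for `D + 1` are h + 1/2: the range 0 < Re h < 1 becomes 1/2 < Re z < 3/2, and Re h <
    -- 1/2 becomes Re z < 1.
    have hD1 : D + 1 = H.map (algebraMap ℝ ℂ) + (1 / 2 : ℂ) • 1 := by
      rw [hD]
      ext i j
      by_cases hij : i = j
      · subst hij
        simp
        ring
      · simp [hij]
    rw [hD1] at hz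
    exact OFBM.isRoot_charpoly_of_mem_roots_minpoly hz
  have hre : ∀ z : ℂ, (z - 1 / 2).re = z.re - 1 / 2 := fun z => by simp
  refine ⟨fun i j => OFBM.hasFourierL2_kernel (fun z hz => ?_) hs t i j,
    fun hH2 i j => OFBM.integrable_kernel_and_integral_eq (fun z hz => ?_) hs t i j⟩
  · have h := hH _ (hroot z hz)
    rw [hre] at h
    exact ⟨by linarith [h.1], by linarith [h.2.1]⟩
  · have h := hH _ (hroot z hz)
    have h2 := hH2 _ (hroot z hz)
    rw [hre] at h h2
    exact ⟨by linarith [h.1], by linarith⟩
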